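/- A \emph{bigraph} is a finite loopless undirected multigraph each of whose edges is either solid or dotted, parallel edges having the same line style. Its matrix $A_G$ is the symmetric integer matrix, indexed by the vertices of $G$, with diagonal entries $2$ and, for $i\ne j$, $(A_G)_{ij}=+m$ (resp. $-m$) if $i$ and $j$ are joined by $m$ dotted (resp. solid) edges. A bigraph $G$ with $n$ vertices has \emph{Dynkin type} $\mathbb{A}_n$ (resp. $\mathbb{D}_n$, for $n\ge 4$) if, after the vertices are numbered $1,\dots,n$, one has $C=M^{\mathrm T}A_GM$ for some $M\in\mathrm{GL}_n(\mathbb{Z})$, where $C$ is the Cartan matrix of the Dynkin diagram $\mathbb{A}_n$ (resp. $\mathbb{D}_n$). For two nonadjacent vertices $u,v$ of a bigraph $J$, the \emph{identification} $J/\{u,v\}$ is obtained by replacing $u$ and $v$ by a single vertex incident to all the edges that are incident to $u$ or $v$, and then cancelling pairs of parallel edges of opposite line styles. A vertex is \emph{separating} if its removal disconnects two other vertices that lie in the same connected component. $d_J(u,v)$ denotes the number of edges of a shortest path from $u$ to $v$ in $J$. \textbf{Theorem.} Let $n\ge4$. In a bigraph of Dynkin type $\mathbb{A}_{n+1}$ any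 two vertices are joined by exactly one shortest path. A bigraph $G$ with $n$ vertices has Dynkin type $\mathbb{D}_n$ if and only if there exist a bigraph $J$ of Dynkin type $\mathbb{A}_{n+1}$ and two non-separating vertices $u$ and $v$ of $J$ such that $d_J(u,v)\ge 2$, the shortest path from $u$ to $v$ in $J$ has an odd number of dotted edges, and $G$ is isomorphic to $J/\{u,v\}$. -/

import Mathlib

universe u v

/-- A bigraph on the vertex set `V`: a loopless undirected multigraph each of whose edges is
either solid or dotted, parallel edges having the same line style.  It is recorded by the numbers
`solid i j` and `dotted i j` of solid and of dotted edges with endpoints `i` and `j`. -/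
@[ext]
structure Bigraph (V : Type u) where
  solid : V → V → ℕ
  dotted : V → V → ℕ
  solid_symm : ∀ i j, solid i j = solid j i
  dotted_symm : ∀ i j, dotted i j = dotted j i
  solid_loopless : ∀ i, solid i i = 0
  dotted_loopless : ∀ i, dotted i i = 0
  same_style : ∀ i j, solid i j = 0 ∨ dotted i j = 0

/-- Two square integer matrices are `ℤ`-equivalent if `B = Mᵀ * A * M` for some integer matrix `M`
that has an integer inverse `N`.  The index sets may differ; then `M` also renames the indices. -/
def ZEquivalent {I : Type u} {J : Type v} [Fintype I] [DecidableEq I] [Fintype J] [DecidableEq J]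
    (A : Matrix I I ℤ) (B : Matrix J J ℤ) : Prop :=
  ∃ (M : Matrix I J ℤ) (N : Matrix J I ℤ),
    M * N = 1 ∧ N * M = 1 ∧ B = M.transpose * A * M

namespace Bigraph

/-- The symmetric quasi-Cartan matrix of a bigraph: `2` on the diagonal; off the diagonal, the
absolute value of an entry is the number of edges, and it is positive for dotted edges and negative
for solid ones. -/
def toMatrix {V : Type u} [DecidableEq V] (G : Bigraph V) : Matrix V V ℤ :=
  Matrix.of fun i j => if i = j then 2 else (G.dotted i j : ℤ) - (G.solid i j : ℤ)

/-- `G` has Dynkin type the Dynkin diagram with Cartan matrix `C`. -/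
def HasDynkinType {V : Type u} [Fintype V] [DecidableEq V] (G : Bigraph V) {n : ℕ}
    (C : Matrix (Fin n) (Fin n) ℤ) : Prop :=
  ZEquivalent G.toMatrix C

/-- The simple graph in which two vertices are adjacent if the bigraph has an edge, of either line
style, between them. -/
def graph {V : Type u} (G : Bigraph V) : SimpleGraph V where
  Adj i j := 0 < G.solid i j + G.dotted i j
  symm := ⟨fun i j h => by rwa [G.solid_symm j i, G.dotted_symm j i]⟩
  loopless := ⟨fun i h => by simp [G.solid_loopless, G.dotted_loopless] at h⟩

/-- The vertex `x` is separating: its removal disconnects two other vertices that are connected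
in `G`. -/
def IsSeparating {V : Type u} (G : Bigraph V) (x : V) : Prop :=
  ∃ a b : {w : V // w ∈ ({x}ᶜ : Set V)},
    G.graph.Reachable a.1 b.1 ∧ ¬ (G.graph.induce ({x}ᶜ : Set V)).Reachable a b

/-- A walk is a shortest path if it is a path whose length is the distance of its ends. -/
def IsShortestPath {V : Type u} (G : Bigraph V) {x y : V} (p : G.graph.Walk x y) : Prop :=
  p.IsPath ∧ p.length = G.graph.dist x y

/-- The number of dotted edges on a walk. -/
def numDotted {V : Type u} (G : Bigraph V) {x y : V} (p : G.graph.Walk x y) : ℕ :=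
  p.darts.countP fun d => 0 < G.dotted d.fst d.snd

/-- Two bigraphs are isomorphic if a bijection between their vertex sets preserves the numbers of
solid and of dotted edges. -/
def Isomorphic {V : Type u} {W : Type v} (G : Bigraph V) (H : Bigraph W) : Prop :=
  ∃ e : V ≃ W, ∀ i j, G.solid i j = H.solid (e i) (e j) ∧ G.dotted i j = H.dotted (e i) (e j)

/-- The vertices after the identification of `x` and `y`: the vertices other than `x` and `y`, and
one new vertex `none` that replaces both. -/
abbrev IdVertex {V : Type u} (x y : V) : Type u := Option {w : V // w ≠ x ∧ w ≠ y}

/-- The vertices of the original bigraph that become the vertex `a`. -/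
def idFiber {V : Type u} [DecidableEq V] (x y : V) : IdVertex x y → Finset V
  | none => {x, y}
  | some w => {w.1}

/-- The number of edges between `a` and `b` after the identification of `x` and `y`, where `m`
counts the edges (of one line style) before it. -/
def idCount {V : Type u} [DecidableEq V] (x y : V) (m : V → V → ℕ) (a b : IdVertex x y) : ℕ :=
  ∑ i ∈ idFiber x y a, ∑ j ∈ idFiber x y b, m i j

theorem idCount_symm {V : Type u} [DecidableEq V] (x y : V) (m : V → V → ℕ)
    (hm : ∀ i j, m i j = m j i) (a b : IdVertex x y) : idCount x y m a b = idCount x y m b a := by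
  unfold idCount
  rw [Finset.sum_comm]
  exact Finset.sum_congr rfl fun i _ => Finset.sum_congr rfl fun j _ => hm j i

theorem idCount_self {V : Type u} [DecidableEq V] (x y : V) (m : V → V → ℕ)
    (hm : ∀ i j, m i j = m j i) (h0 : ∀ i, m i i = 0) (hxy : m x y = 0) (a : IdVertex x y) :
    idCount x y m a a = 0 := by
  refine Finset.sum_eq_zero fun i hi => Finset.sum_eq_zero fun j hj => ?_
  have hyx : m y x = 0 := by rw [hm, hxy]
  cases a with
  | none =>
    simp only [idFiber, Finset.mem_insert, Finset.mem_singleton] at hi hj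
    rcases hi with rfl | rfl <;> rcases hj with rfl | rfl <;> simp [h0, hxy, hyx]
  | some w =>
    simp only [idFiber, Finset.mem_singleton] at hi hj
    rw [hi, hj, h0]

/-- The identification `G / {x, y}` of two nonadjacent vertices `x` and `y`: they are replaced by a
single vertex incident to all edges that are incident to `x` or to `y`, and then pairs of parallel
edges of opposite line styles cancel out (the natural number subtractions are truncated). -/
def identify {V : Type u} [DecidableEq V] (G : Bigraph V) (x y : V) (h : ¬ G.graph.Adj x y) :
    Bigraph (IdVertex x y) where
  solid a b := idCount x y G.solid a b - idCount x y G.dotted a b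
  dotted a b := idCount x y G.dotted a b - idCount x y G.solid a b
  solid_symm a b := by
    rw [idCount_symm x y _ G.solid_symm a b, idCount_symm x y _ G.dotted_symm a b]
  dotted_symm a b := by
    rw [idCount_symm x y _ G.solid_symm a b, idCount_symm x y _ G.dotted_symm a b]
  solid_loopless a := by
    have h' : G.solid x y = 0 := by simp only [graph] at h; omega
    rw [idCount_self x y _ G.solid_symm G.solid_loopless h', Nat.zero_sub]
  dotted_loopless a := by
    have h' : G.dotted x y = 0 := by simp only [graph] at h; omega
    rw [idCount_self x y _ G.dotted_symm G.dotted_loopless h', Nat.zero_sub]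
  same_style a b := by omega

/-- Vertices at distance at least two are not adjacent. -/
theorem not_adj_of_two_le_dist {V : Type u} (G : Bigraph V) {x y : V}
    (h : 2 ≤ G.graph.dist x y) : ¬ G.graph.Adj x y := fun hadj => by
  rw [SimpleGraph.dist_eq_one_iff_adj.mpr hadj] at h
  omega

end Bigraph

/-! The root lattice of type A is the lattice of integer vectors with coordinate sum zero, and that
of type D is the lattice of vectors with even coordinate sum. Having one of these Dynkin types means
that the matrix of the bigraph is the Gram matrix of a basis of that lattice (`IsRealizedBy`). All
basis vectors have squared length 2, so they are of the form ±e_i ± e_j, and the question becomes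
one about graphs on the coordinates.

Type A: each vector is e_i - e_j, an oriented edge, and a basis is the edge set of a spanning tree.
Thus `J` is a signed line graph of a tree (`IsTreeLineGraph`): vertices are adjacent when the edges
share a point, by a solid line if the orientations are consistent along the path through that point
and by a dotted one otherwise. Dual vectors act as cuts of the tree. They show that shortest paths
are unique and that a non-separating vertex is an edge ending in a leaf. Since orientation flips
exactly at dotted lines, two such edges are joined by a path with an odd number of dotted lines iff
both point towards their leaves or both away (`odd_numDotted_iff`).

Folding: for such a pair σ(e_q - e_p), σ(e_q' - e_p') with leaves p, p', identification adds the two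
vectors. Deleting the coordinates p and p', which no other vector uses, leaves σ(e_q + e_q'), of
squared length 2 again. Together with the remaining tree edges it generates the even-sum lattice
(`IsRealizedBy.identify`).

Unfolding: in a basis of the even-sum lattice, sign changes of the coordinates turn a spanning tree
of vectors into differences e_i - e_j. The one remaining vector must then be σ(e_a + e_b)
(`exists_switching`), and it splits into two edges from a and b to new leaves (`span_unfolding`),
which reverses the folding. -/

open Matrix

/-! ### The sum-zero and even-sum lattices and their vectors of squared length two. -/

section Lattices

variable {P : Type*} [Fintype P]

/-- The lattice of integer vectors with coordinate sum zero. -/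
def sumZeroLattice (P : Type*) [Fintype P] : Submodule ℤ (P → ℤ) where
  carrier := {x | ∑ i, x i = 0}
  add_mem' {x y} hx hy := by
    simp only [Set.mem_ofPred_eq] at *
    simp [Finset.sum_add_distrib, hx, hy]
  zero_mem' := by simp
  smul_mem' c x hx := by
    simp only [Set.mem_ofPred_eq] at *
    simp [← Finset.mul_sum, hx]

/-- The lattice of integer vectors with even coordinate sum. -/
def evenSumLattice (P : Type*) [Fintype P] : Submodule ℤ (P → ℤ) where
  carrier := {x | Even (∑ i, x i)}
  add_mem' {x y} hx hy := by
    simp only [Set.mem_ofPred_eq] at *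
    simpa [Finset.sum_add_distrib] using hx.add hy
  zero_mem' := by simp
  smul_mem' c x hx := by
    simp only [Set.mem_ofPred_eq] at *
    simpa [← Finset.mul_sum] using hx.mul_left c

theorem mem_sumZeroLattice {x : P → ℤ} : x ∈ sumZeroLattice P ↔ ∑ i, x i = 0 := Iff.rfl

theorem mem_evenSumLattice {x : P → ℤ} : x ∈ evenSumLattice P ↔ Even (∑ i, x i) := Iff.rfl

variable [DecidableEq P]

theorem single_sub_single_mem_sumZeroLattice (i j : P) :
    (Pi.single i 1 - Pi.single j 1 : P → ℤ) ∈ sumZeroLattice P := by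
  simp [mem_sumZeroLattice]

theorem single_add_single_mem_evenSumLattice (i j : P) :
    (Pi.single i 1 + Pi.single j 1 : P → ℤ) ∈ evenSumLattice P := by
  simp [mem_evenSumLattice, Finset.sum_add_distrib]

theorem sumZeroLattice_le {S : Submodule ℤ (P → ℤ)} (p : P)
    (h : ∀ i, (Pi.single i 1 - Pi.single p 1 : P → ℤ) ∈ S) : sumZeroLattice P ≤ S := by
  intro x hx
  rw [mem_sumZeroLattice] at hx
  have : x = ∑ i, x i • (Pi.single i 1 - Pi.single p 1 : P → ℤ) := by
    simp only [smul_sub, Finset.sum_sub_distrib, ← Finset.sum_smul, hx, zero_smul, sub_zero]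
    ext k
    simp [Finset.sum_apply, Pi.single_apply]
  rw [this]
  exact S.sum_mem fun i _ => S.smul_mem _ (h i)

theorem evenSumLattice_le {S : Submodule ℤ (P → ℤ)} (h : sumZeroLattice P ≤ S) (a b : P)
    (hab : (Pi.single a 1 + Pi.single b 1 : P → ℤ) ∈ S) : evenSumLattice P ≤ S := by
  rintro x ⟨m, hm⟩
  have : x - m • (Pi.single a 1 + Pi.single b 1 : P → ℤ) ∈ S := h <| by
    simp [mem_sumZeroLattice, Finset.sum_sub_distrib, Finset.sum_add_distrib, ← Finset.mul_sum, hm]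
  simpa using S.add_mem this (S.smul_mem m hab)

/-- An integer vector of squared length two has exactly two nonzero entries, both `±1`. -/
theorem exists_eq_single_add_single {x : P → ℤ} (h : x ⬝ᵥ x = 2) :
    ∃ i j, i ≠ j ∧ ∃ σ τ : ℤ, (σ = 1 ∨ σ = -1) ∧ (τ = 1 ∨ τ = -1) ∧
      x = Pi.single i σ + Pi.single j τ := by
  have unit : ∀ a : ℤ, a ≠ 0 → a * a ≤ 2 → a = 1 ∨ a = -1 := by
    intro a h0 h2
    have h1 : a ≤ 1 := by nlinarith
    have h3 : -1 ≤ a := by nlinarith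
    omega
  simp only [dotProduct] at h
  have le2 : ∀ i, x i * x i ≤ 2 := fun i => h ▸
    Finset.single_le_sum (f := fun i => x i * x i) (fun i _ => mul_self_nonneg (x i))
      (Finset.mem_univ i)
  obtain ⟨i, -, hi⟩ := Finset.exists_ne_zero_of_sum_ne_zero (by rw [h]; norm_num :
    ∑ i, x i * x i ≠ 0)
  have hi1 := unit (x i) (left_ne_zero_of_mul hi) (le2 i)
  have hii : x i * x i = 1 := by rcases hi1 with h | h <;> rw [h] <;> norm_num
  rw [← Finset.add_sum_erase _ _ (Finset.mem_univ i), hii] at h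
  have h1 : ∑ k ∈ Finset.univ.erase i, x k * x k = 1 := by linarith
  obtain ⟨j, hj, hj0⟩ := Finset.exists_ne_zero_of_sum_ne_zero (by rw [h1]; norm_num :
    ∑ k ∈ Finset.univ.erase i, x k * x k ≠ 0)
  have hj1 := unit (x j) (left_ne_zero_of_mul hj0) (le2 j)
  have hjj : x j * x j = 1 := by rcases hj1 with h | h <;> rw [h] <;> norm_num
  rw [← Finset.add_sum_erase _ _ hj, hjj] at h1
  have h2 : ∑ k ∈ (Finset.univ.erase i).erase j, x k * x k = 0 := by linarith
  rw [Finset.sum_eq_zero_iff_of_nonneg (fun k _ => mul_self_nonneg (x k))] at h2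
  have hji : j ≠ i := Finset.ne_of_mem_erase hj
  refine ⟨i, j, hji.symm, x i, x j, hi1, hj1, ?_⟩
  ext k
  by_cases hki : k = i
  · subst hki; simp [hji.symm]
  · by_cases hkj : k = j
    · subst hkj; simp [hki]
    · have := h2 k (by simp [hki, hkj])
      simp [hki, hkj, mul_self_eq_zero.mp this]

theorem exists_eq_single_sub_single {x : P → ℤ} (h : x ⬝ᵥ x = 2) (h0 : ∑ i, x i = 0) :
    ∃ i j, i ≠ j ∧ x = Pi.single i 1 - Pi.single j 1 := by
  obtain ⟨i, j, hij, σ, τ, hσ, hτ, rfl⟩ := exists_eq_single_add_single h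
  simp only [Pi.add_apply, Finset.sum_add_distrib, Finset.sum_pi_single', Finset.mem_univ,
    if_true] at h0
  rcases hσ with rfl | rfl
  · obtain rfl : τ = -1 := by omega
    exact ⟨i, j, hij, by rw [Pi.single_neg, sub_eq_add_neg]⟩
  · obtain rfl : τ = 1 := by omega
    exact ⟨j, i, hij.symm, by rw [Pi.single_neg, sub_eq_add_neg, add_comm]⟩

end Lattices

/-! ### Dynkin types as Gram matrices of generators of a lattice. -/

namespace Bigraph

variable {V : Type*} [DecidableEq V] {P Q : Type*} [Fintype P] [Fintype Q]

/-- The vectors `r v` have the matrix of `G` as their Gram matrix and generate the lattice `L`. -/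
structure IsRealizedBy (G : Bigraph V) (r : V → P → ℤ) (L : Submodule ℤ (P → ℤ)) : Prop where
  gram : ∀ v w, G.toMatrix v w = r v ⬝ᵥ r w
  span : Submodule.span ℤ (Set.range r) = L

theorem IsRealizedBy.mem {G : Bigraph V} {r : V → P → ℤ} {L : Submodule ℤ (P → ℤ)}
    (h : G.IsRealizedBy r L) (v : V) : r v ∈ L :=
  h.span ▸ Submodule.subset_span ⟨v, rfl⟩

theorem IsRealizedBy.reindex {G : Bigraph V} {r : V → P → ℤ} {L : Submodule ℤ (P → ℤ)}
    {L' : Submodule ℤ (Q → ℤ)} (h : G.IsRealizedBy r L) (e : P ≃ Q)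
    (hL : ∀ x, x ∈ L' ↔ x ∘ e ∈ L) : G.IsRealizedBy (fun v => r v ∘ e.symm) L' where
  gram v w := by
    rw [h.gram, dotProduct, dotProduct]
    exact (Equiv.sum_comp e.symm fun i => r v i * r w i).symm
  span := by
    have hr : (fun v => r v ∘ e.symm) = LinearMap.funLeft ℤ ℤ e.symm ∘ r := rfl
    rw [hr, Set.range_comp, ← Submodule.map_span, h.span]
    ext x
    rw [hL, Submodule.mem_map]
    constructor
    · rintro ⟨y, hy, rfl⟩
      convert hy using 1
      ext i
      simp [LinearMap.funLeft]
    · intro hx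
      refine ⟨x ∘ e, hx, ?_⟩
      ext q
      simp [LinearMap.funLeft]

theorem IsRealizedBy.reindex_sumZeroLattice {G : Bigraph V} {r : V → P → ℤ}
    (h : G.IsRealizedBy r (sumZeroLattice P)) (e : P ≃ Q) :
    G.IsRealizedBy (fun v => r v ∘ e.symm) (sumZeroLattice Q) :=
  h.reindex e fun x => by
    rw [mem_sumZeroLattice, mem_sumZeroLattice, ← Equiv.sum_comp e x]
    rfl

theorem IsRealizedBy.reindex_evenSumLattice {G : Bigraph V} {r : V → P → ℤ}
    (h : G.IsRealizedBy r (evenSumLattice P)) (e : P ≃ Q) :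
    G.IsRealizedBy (fun v => r v ∘ e.symm) (evenSumLattice Q) :=
  h.reindex e fun x => by
    rw [mem_evenSumLattice, mem_evenSumLattice, ← Equiv.sum_comp e x]
    rfl

variable [Fintype V]

/-- Each family is an integer combination of the other, and independence of the rows of `b` (the
hypothesis `hb`) makes one product of the transition matrices the identity. The other product
follows because `V` has exactly `n` elements, so independence of `r` need not be assumed. -/
theorem IsRealizedBy.exists_base_change {n : ℕ} {G : Bigraph V} {r : V → P → ℤ}
    {b : Matrix (Fin n) P ℤ} (h : G.IsRealizedBy r (Submodule.span ℤ (Set.range b)))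
    (hb : ∀ X : Matrix (Fin n) (Fin n) ℤ, X * b = 0 → X = 0) (hn : Fintype.card V = n) :
    ∃ (Z : Matrix (Fin n) V ℤ) (N : Matrix V (Fin n) ℤ),
      Z * Matrix.of r = b ∧ N * b = Matrix.of r ∧ Z * N = 1 ∧ N * Z = 1 := by
  have hZ : ∀ k, ∃ c : V → ℤ, ∑ v, c v • r v = b k := fun k => by
    rw [← Submodule.mem_span_range_iff_exists_fun, h.span]
    exact Submodule.subset_span ⟨k, rfl⟩
  have hN : ∀ v, ∃ c : Fin n → ℤ, ∑ k, c k • b k = r v := fun v =>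
    (Submodule.mem_span_range_iff_exists_fun ℤ).mp (h.mem v)
  choose Z hZ using hZ
  choose N hN using hN
  have hZ' : Matrix.of Z * Matrix.of r = b := by
    ext k i
    rw [← hZ]
    simp [Matrix.mul_apply, Finset.sum_apply]
  have hN' : Matrix.of N * b = Matrix.of r := by
    ext k i
    rw [Matrix.of_apply, ← hN]
    simp [Matrix.mul_apply, Finset.sum_apply]
  have h1 : Matrix.of Z * Matrix.of N = 1 := by
    rw [← sub_eq_zero]
    apply hb
    rw [Matrix.sub_mul, Matrix.mul_assoc, hN', hZ', Matrix.one_mul, sub_self]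
  exact ⟨_, _, hZ', hN', h1, (Matrix.mul_eq_one_comm_of_card_eq _ V ℤ (by simp [hn])).mp h1⟩

theorem IsRealizedBy.hasDynkinType {n : ℕ} {C : Matrix (Fin n) (Fin n) ℤ} {G : Bigraph V}
    {r : V → P → ℤ} {b : Matrix (Fin n) P ℤ}
    (h : G.IsRealizedBy r (Submodule.span ℤ (Set.range b))) (hC : C = b * bᵀ)
    (hb : ∀ X : Matrix (Fin n) (Fin n) ℤ, X * b = 0 → X = 0) (hn : Fintype.card V = n) :
    G.HasDynkinType C := by
  obtain ⟨Z, N, hZ, -, h1, h2⟩ := h.exists_base_change hb hn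
  have hA : G.toMatrix = Matrix.of r * (Matrix.of r)ᵀ := by
    ext v w
    rw [h.gram]
    rfl
  refine ⟨Zᵀ, Nᵀ, ?_, ?_, ?_⟩
  · rw [← Matrix.transpose_mul, h2, Matrix.transpose_one]
  · rw [← Matrix.transpose_mul, h1, Matrix.transpose_one]
  · rw [hC, Matrix.transpose_transpose, hA, ← Matrix.mul_assoc, hZ, Matrix.mul_assoc,
      ← Matrix.transpose_mul, hZ]

theorem HasDynkinType.card_eq {n : ℕ} {C : Matrix (Fin n) (Fin n) ℤ} {G : Bigraph V}
    (h : G.HasDynkinType C) : Fintype.card V = n := by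
  obtain ⟨M, N, h1, h2, -⟩ := h
  simpa using Matrix.square_of_invertible M N h1 h2

/-- With `C = Mᵀ A M` and `N` inverse to `M`, one has `A = Nᵀ C N`, so the rows of `Nᵀ * b` have
Gram matrix `A`; multiplying by `Mᵀ` recovers `b`. -/
theorem HasDynkinType.exists_isRealizedBy {n : ℕ} {C : Matrix (Fin n) (Fin n) ℤ} {G : Bigraph V}
    (h : G.HasDynkinType C) {b : Matrix (Fin n) P ℤ} (hC : C = b * bᵀ) :
    ∃ r : V → P → ℤ, G.IsRealizedBy r (Submodule.span ℤ (Set.range b)) := by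
  obtain ⟨M, N, h1, h2, h3⟩ := h
  have hA : G.toMatrix = (Nᵀ * b) * (Nᵀ * b)ᵀ := by
    rw [Matrix.transpose_mul, Matrix.transpose_transpose, Matrix.mul_assoc, ← Matrix.mul_assoc b,
      ← hC, h3]
    simp only [Matrix.mul_assoc, h1, Matrix.mul_one]
    rw [← Matrix.mul_assoc, ← Matrix.transpose_mul, h1, Matrix.transpose_one, Matrix.one_mul]
  have hM : Mᵀ * (Nᵀ * b) = b := by
    rw [← Matrix.mul_assoc, ← Matrix.transpose_mul, h2, Matrix.transpose_one, Matrix.one_mul]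
  refine ⟨Nᵀ * b, ⟨fun v w => ?_, le_antisymm ?_ ?_⟩⟩
  · rw [hA]
    rfl
  · rw [Submodule.span_le]
    rintro _ ⟨v, rfl⟩
    have : (Nᵀ * b) v = ∑ k, N k v • b k := by
      ext i
      simp [Matrix.mul_apply, Finset.sum_apply]
    rw [this]
    exact Submodule.sum_mem _ fun k _ => Submodule.smul_mem _ _ (Submodule.subset_span ⟨k, rfl⟩)
  · rw [Submodule.span_le]
    rintro _ ⟨k, rfl⟩
    have : b k = ∑ v, M v k • (Nᵀ * b) v := by
      nth_rw 1 [← hM]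
      ext i
      rw [Matrix.mul_apply]
      simp [Finset.sum_apply]
    rw [this]
    exact Submodule.sum_mem _ fun k _ => Submodule.smul_mem _ _ (Submodule.subset_span ⟨k, rfl⟩)

/-! ### The root lattices of types A and D. -/

/-- The simple roots of type `A`. -/
def simpleRootsA (n : ℕ) : Matrix (Fin n) (Fin (n + 1)) ℤ :=
  fun k => Pi.single k.castSucc 1 - Pi.single k.succ 1

/-- The fundamental coweights of type `A`, up to multiples of the all-one vector. -/
def fundamentalWeightsA (n : ℕ) : Matrix (Fin (n + 1)) (Fin n) ℤ :=
  fun i k => if i ≤ k.castSucc then 1 else 0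

theorem simpleRootsA_mul_fundamentalWeightsA (n : ℕ) :
    simpleRootsA n * fundamentalWeightsA n = 1 := by
  ext k l
  simp only [Matrix.mul_apply', simpleRootsA, sub_dotProduct, single_one_dotProduct,
    fundamentalWeightsA, Matrix.one_apply, Fin.le_def, Fin.ext_iff]
  simp only [Fin.val_castSucc, Fin.val_succ]
  split_ifs <;> omega

theorem cartanMatrixA_eq (n : ℕ) : CartanMatrix.A n = simpleRootsA n * (simpleRootsA n)ᵀ := by
  ext k l
  simp only [Matrix.mul_apply', simpleRootsA, sub_dotProduct, single_one_dotProduct,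
    Matrix.transpose_apply, CartanMatrix.A, Pi.sub_apply, Pi.single_apply, Matrix.of_apply,
    Fin.ext_iff]
  simp only [Fin.val_castSucc, Fin.val_succ]
  split_ifs <;> omega

theorem span_simpleRootsA (n : ℕ) :
    Submodule.span ℤ (Set.range (simpleRootsA n)) = sumZeroLattice (Fin (n + 1)) := by
  refine le_antisymm ?_ (sumZeroLattice_le 0 fun i => ?_)
  · rw [Submodule.span_le]
    rintro _ ⟨k, rfl⟩
    exact single_sub_single_mem_sumZeroLattice _ _
  · induction i using Fin.induction with
    | zero => simp
    | succ k ih =>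
      have : (Pi.single k.succ 1 - Pi.single 0 1 : Fin (n + 1) → ℤ) =
          (Pi.single k.castSucc 1 - Pi.single 0 1) - simpleRootsA n k := by
        simp [simpleRootsA]
      rw [this]
      exact Submodule.sub_mem _ ih (Submodule.subset_span ⟨k, rfl⟩)

theorem eq_zero_of_mul_simpleRootsA {n : ℕ} (X : Matrix (Fin n) (Fin n) ℤ)
    (hX : X * simpleRootsA n = 0) : X = 0 := by
  rw [← Matrix.mul_one X, ← simpleRootsA_mul_fundamentalWeightsA, ← Matrix.mul_assoc, hX,
    Matrix.zero_mul]

theorem IsRealizedBy.hasDynkinType_A {n : ℕ} {G : Bigraph V} {r : V → P → ℤ}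
    (h : G.IsRealizedBy r (sumZeroLattice P)) (hV : Fintype.card V = n)
    (hP : Fintype.card P = n + 1) : G.HasDynkinType (CartanMatrix.A n) := by
  have h' := h.reindex_sumZeroLattice (Fintype.equivFinOfCardEq hP)
  rw [← span_simpleRootsA] at h'
  exact h'.hasDynkinType (cartanMatrixA_eq n) eq_zero_of_mul_simpleRootsA hV

/-- Vectors dual to a basis of the lattice of vectors with coordinate sum zero. -/
theorem IsRealizedBy.exists_dual {G : Bigraph V} {r : V → P → ℤ}
    (h : G.IsRealizedBy r (sumZeroLattice P)) (hP : Fintype.card P = Fintype.card V + 1) :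
    ∃ f : V → P → ℤ, ∀ v w, r v ⬝ᵥ f w = if v = w then 1 else 0 := by
  set e := Fintype.equivFinOfCardEq hP
  have h' := h.reindex_sumZeroLattice e
  rw [← span_simpleRootsA] at h'
  obtain ⟨Z, N, -, hN, -, h2⟩ := h'.exists_base_change eq_zero_of_mul_simpleRootsA rfl
  -- Since `r = N * simpleRootsA` after renaming coordinates, pulling the weights dual to the simple
  -- roots back along `Z` gives the dual of `r`.
  set B : Matrix (Fin (Fintype.card V + 1)) V ℤ :=
    fundamentalWeightsA (Fintype.card V) * Z with hB
  have h3 : Matrix.of (fun v => r v ∘ e.symm) * B = (1 : Matrix V V ℤ) := by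
    rw [← hN, hB, Matrix.mul_assoc, ← Matrix.mul_assoc (simpleRootsA _),
      simpleRootsA_mul_fundamentalWeightsA, Matrix.one_mul, h2]
  refine ⟨fun w i => B (e i) w, fun v w => ?_⟩
  rw [← Matrix.one_apply, ← h3, Matrix.mul_apply, dotProduct, ← Equiv.sum_comp e]
  simp

theorem HasDynkinType.exists_isRealizedBy_sumZeroLattice {n : ℕ} {G : Bigraph V}
    (h : G.HasDynkinType (CartanMatrix.A n)) :
    ∃ r : V → Fin (n + 1) → ℤ, G.IsRealizedBy r (sumZeroLattice (Fin (n + 1))) :=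
  span_simpleRootsA n ▸ h.exists_isRealizedBy (cartanMatrixA_eq n)

/-- The simple roots of type `D`. -/
def simpleRootsD (n : ℕ) : Matrix (Fin n) (Fin n) ℤ := fun k =>
  if h : k.val + 1 < n then Pi.single k 1 - Pi.single ⟨k.val + 1, h⟩ 1
  else Pi.single ⟨k.val - 1, by omega⟩ 1 + Pi.single k 1

theorem cartanMatrixD_eq {n : ℕ} (hn : 3 ≤ n) :
    CartanMatrix.D n = simpleRootsD n * (simpleRootsD n)ᵀ := by
  ext k l
  simp only [Matrix.mul_apply', simpleRootsD, Matrix.transpose_apply, CartanMatrix.D,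
    Matrix.of_apply]
  by_cases hk : k.val + 1 < n <;> by_cases hl : l.val + 1 < n <;>
    simp only [hk, hl, dite_true, dite_false, sub_dotProduct, add_dotProduct,
      single_one_dotProduct, Pi.sub_apply, Pi.add_apply, Pi.single_apply,
      Fin.ext_iff] <;>
    split_ifs <;> omega

theorem span_simpleRootsD {n : ℕ} (hn : 2 ≤ n) :
    Submodule.span ℤ (Set.range (simpleRootsD n)) = evenSumLattice (Fin n) := by
  obtain ⟨m, rfl⟩ : ∃ m, n = m + 2 := ⟨n - 2, by omega⟩
  refine le_antisymm ?_ (evenSumLattice_le (sumZeroLattice_le 0 fun i => ?_)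
    (Fin.last m).castSucc (Fin.last _) ?_)
  · rw [Submodule.span_le]
    rintro _ ⟨k, rfl⟩
    simp only [SetLike.mem_coe, simpleRootsD]
    split_ifs
    · simp [mem_evenSumLattice]
    · exact single_add_single_mem_evenSumLattice _ _
  · induction i using Fin.induction with
    | zero => simp
    | succ k ih =>
      have : (Pi.single k.succ 1 - Pi.single 0 1 : Fin (m + 2) → ℤ) =
          (Pi.single k.castSucc 1 - Pi.single 0 1) - simpleRootsD (m + 2) k.castSucc := by
        have hk : k.castSucc.val + 1 < m + 2 := by
          have := k.isLt
          simp only [Fin.val_castSucc]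
          omega
        simp only [simpleRootsD, hk, dite_true]
        have : (⟨k.castSucc.val + 1, hk⟩ : Fin (m + 2)) = k.succ := rfl
        rw [this]
        abel
      rw [this]
      exact Submodule.sub_mem _ ih (Submodule.subset_span ⟨k.castSucc, rfl⟩)
  · apply Submodule.subset_span
    refine ⟨Fin.last _, ?_⟩
    simp [simpleRootsD]
    rfl

/-- The vectors 2e_i have even sum, so some integer matrix times `simpleRootsD n` is twice the
identity; hence the determinant is nonzero. -/
theorem eq_zero_of_mul_simpleRootsD {n : ℕ} (hn : 2 ≤ n) (X : Matrix (Fin n) (Fin n) ℤ)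
    (hX : X * simpleRootsD n = 0) : X = 0 := by
  have hY : ∀ i : Fin n, ∃ c : Fin n → ℤ,
      ∑ k, c k • simpleRootsD n k = Pi.single i 1 + Pi.single i 1 := fun i =>
    (Submodule.mem_span_range_iff_exists_fun ℤ).mp <| by
      rw [span_simpleRootsD hn]
      exact single_add_single_mem_evenSumLattice i i
  choose Y hY using hY
  have hY' : Matrix.of Y * simpleRootsD n = (2 : ℤ) • (1 : Matrix (Fin n) (Fin n) ℤ) := by
    ext i j
    have := congrFun (hY i) j
    simp only [Finset.sum_apply, Pi.smul_apply, smul_eq_mul] at this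
    rw [Matrix.mul_apply]
    simp only [Matrix.of_apply, this, Matrix.smul_apply, Matrix.one_apply, Pi.add_apply,
      Pi.single_apply, smul_eq_mul, eq_comm (a := j)]
    split_ifs <;> norm_num
  have hdet : (simpleRootsD n).det ≠ 0 := by
    intro h0
    have := congrArg Matrix.det hY'
    rw [Matrix.det_mul, h0, mul_zero, Matrix.det_smul, Matrix.det_one, mul_one] at this
    exact pow_ne_zero _ two_ne_zero this.symm
  have h1 : (simpleRootsD n).det • X = 0 := by
    have := congrArg (· * (simpleRootsD n).adjugate) hX
    simpa only [Matrix.mul_assoc, Matrix.mul_adjugate, Matrix.mul_smul, Matrix.mul_one,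
      Matrix.zero_mul] using this
  exact (smul_eq_zero.mp h1).resolve_left hdet

theorem HasDynkinType.exists_isRealizedBy_evenSumLattice {n : ℕ} (hn : 3 ≤ n) {G : Bigraph V}
    (h : G.HasDynkinType (CartanMatrix.D n)) :
    ∃ r : V → Fin n → ℤ, G.IsRealizedBy r (evenSumLattice (Fin n)) :=
  span_simpleRootsD (n := n) (by omega) ▸ h.exists_isRealizedBy (cartanMatrixD_eq hn)

theorem IsRealizedBy.hasDynkinType_D {n : ℕ} (hn : 3 ≤ n) {G : Bigraph V} {r : V → P → ℤ}
    (h : G.IsRealizedBy r (evenSumLattice P)) (hV : Fintype.card V = n)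
    (hP : Fintype.card P = n) : G.HasDynkinType (CartanMatrix.D n) := by
  have h' := h.reindex_evenSumLattice (Fintype.equivFinOfCardEq hP)
  rw [← span_simpleRootsD (by omega)] at h'
  exact h'.hasDynkinType (cartanMatrixD_eq hn) (eq_zero_of_mul_simpleRootsD (by omega)) hV

end Bigraph

/-! ### Oriented edges and their ends. -/

section EdgeEnds

variable {W P : Type*}

/-- The point `p` is an end of the oriented edge `w` from `t w` to `s w`. -/
def IsEnd (s t : W → P) (w : W) (p : P) : Prop := p = s w ∨ p = t w

/-- The edge `w` joins `p` and `q`; it is oriented towards `q` if `σ = 1` and towards `p` if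
`σ = -1`. -/
def Joins (s t : W → P) (w : W) (p q : P) (σ : ℤ) : Prop :=
  (σ = 1 ∧ t w = p ∧ s w = q) ∨ (σ = -1 ∧ s w = p ∧ t w = q)

theorem IsEnd.exists_joins {s t : W → P} {w : W} {p : P} (h : IsEnd s t w p) :
    ∃ q σ, Joins s t w p q σ := by
  rcases h with rfl | rfl
  · exact ⟨t w, -1, Or.inr ⟨rfl, rfl, rfl⟩⟩
  · exact ⟨s w, 1, Or.inl ⟨rfl, rfl, rfl⟩⟩

namespace Joins

variable {s t : W → P} {w : W} {p q : P} {σ : ℤ}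

theorem left (h : Joins s t w p q σ) : IsEnd s t w p := by
  rcases h with ⟨-, rfl, -⟩ | ⟨-, rfl, -⟩
  · exact Or.inr rfl
  · exact Or.inl rfl

theorem right (h : Joins s t w p q σ) : IsEnd s t w q := by
  rcases h with ⟨-, -, rfl⟩ | ⟨-, -, rfl⟩
  · exact Or.inl rfl
  · exact Or.inr rfl

theorem symm (h : Joins s t w p q σ) : Joins s t w q p (-σ) := by
  rcases h with ⟨rfl, rfl, rfl⟩ | ⟨rfl, rfl, rfl⟩
  · exact Or.inr ⟨rfl, rfl, rfl⟩
  · exact Or.inl ⟨by norm_num, rfl, rfl⟩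

theorem isEnd_iff (h : Joins s t w p q σ) {x : P} : IsEnd s t w x ↔ x = p ∨ x = q := by
  rcases h with ⟨rfl, rfl, rfl⟩ | ⟨rfl, rfl, rfl⟩
  · exact or_comm
  · exact Iff.rfl

theorem mul_self (h : Joins s t w p q σ) : σ * σ = 1 := by
  rcases h with ⟨rfl, -⟩ | ⟨rfl, -⟩ <;> norm_num

theorem sub_eq [DecidableEq P] (h : Joins s t w p q σ) :
    (Pi.single (s w) 1 - Pi.single (t w) 1 : P → ℤ) = σ • (Pi.single q 1 - Pi.single p 1) := by
  rcases h with ⟨rfl, rfl, rfl⟩ | ⟨rfl, rfl, rfl⟩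
  · simp
  · simp

end Joins

end EdgeEnds

/-! ### Signed line graphs of trees. -/

namespace Bigraph

theorem adj_iff_toMatrix_ne_zero {W : Type*} [DecidableEq W] (J : Bigraph W) {v w : W}
    (h : v ≠ w) : J.graph.Adj v w ↔ J.toMatrix v w ≠ 0 := by
  have := J.same_style v w
  simp only [graph, toMatrix, Matrix.of_apply, if_neg h]
  omega

theorem dotted_pos_iff {W : Type*} [DecidableEq W] (J : Bigraph W) {v w : W}
    (h : v ≠ w) : 0 < J.dotted v w ↔ 0 < J.toMatrix v w := by
  have := J.same_style v w
  simp only [toMatrix, Matrix.of_apply, if_neg h]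
  omega

/-- The vertices of `J` are the edges `w` of a tree with vertex set `P`, oriented from `t w` to
`s w`, and the off-diagonal entries of the matrix of `J` are the inner products of the columns of
its incidence matrix.  That the edges form a tree is expressed by the existence of cuts separating
the ends of a single edge, and by connectedness. -/
structure IsTreeLineGraph {W P : Type*} [DecidableEq W] [DecidableEq P] (J : Bigraph W)
    (s t : W → P) : Prop where
  entry : ∀ v w, v ≠ w → J.toMatrix v w =
    ((if s v = s w then 1 else 0) - (if s v = t w then 1 else 0)) -
      ((if t v = s w then 1 else 0) - (if t v = t w then 1 else 0))
  cut : ∀ w, ∃ f : P → ℤ, f (s w) ≠ f (t w) ∧ ∀ v, v ≠ w → f (s v) = f (t v)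
  conn : ∀ f : P → ℤ, (∀ w, f (s w) = f (t w)) → ∀ i j, f i = f j

/-- Connectedness comes from generation: a function `f` that is constant on every edge defines a
functional vanishing on all `r w`, hence on the whole sum-zero lattice, in particular on e_i - e_j.
-/
theorem IsRealizedBy.isTreeLineGraph {W P : Type*} [DecidableEq W] [Fintype P] [DecidableEq P]
    {J : Bigraph W} {r : W → P → ℤ} (h : J.IsRealizedBy r (sumZeroLattice P)) {s t : W → P}
    (hr : ∀ w, r w = Pi.single (s w) 1 - Pi.single (t w) 1)
    (hc : ∀ w, ∃ f : P → ℤ, f (s w) ≠ f (t w) ∧ ∀ v, v ≠ w → f (s v) = f (t v)) :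
    J.IsTreeLineGraph s t where
  entry v w hvw := by
    rw [h.gram, hr, hr, sub_dotProduct, single_one_dotProduct, single_one_dotProduct]
    simp [Pi.single_apply]
  cut := hc
  conn f hf i j := by
    have hle : Submodule.span ℤ (Set.range r) ≤ LinearMap.ker (dotProductBilin ℤ ℤ f) := by
      rw [Submodule.span_le]
      rintro _ ⟨w, rfl⟩
      simp [hr, dotProduct_sub, hf]
    rw [h.span] at hle
    have := hle (single_sub_single_mem_sumZeroLattice i j)
    simpa [dotProduct_sub, sub_eq_zero] using this

/-- A bigraph realized by a basis of the lattice of vectors with coordinate sum zero is a signed line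
graph of a tree. -/
theorem IsRealizedBy.exists_isTreeLineGraph {W P : Type*} [Fintype W] [DecidableEq W] [Fintype P]
    [DecidableEq P] {J : Bigraph W} {r : W → P → ℤ} (h : J.IsRealizedBy r (sumZeroLattice P))
    (hP : Fintype.card P = Fintype.card W + 1) :
    ∃ s t : W → P, (∀ w, r w = Pi.single (s w) 1 - Pi.single (t w) 1) ∧ J.IsTreeLineGraph s t := by
  have hr : ∀ w, ∃ i j, i ≠ j ∧ r w = Pi.single i 1 - Pi.single j 1 := fun w =>
    exists_eq_single_sub_single (by rw [← h.gram]; simp [toMatrix]) (h.mem w)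
  choose s t _ hr using hr
  -- The dual vector `f w`, read as a function on the points, jumps by 1 along `w` and is constant
  -- on all other edges: it is the cut at `w`.
  obtain ⟨f, hf⟩ := h.exists_dual hP
  refine ⟨s, t, hr, h.isTreeLineGraph hr fun w => ⟨f w, fun h => ?_, fun v hv => ?_⟩⟩
  · have := hf w w
    rw [hr, sub_dotProduct, single_one_dotProduct, single_one_dotProduct, h] at this
    simp at this
  · have := hf v w
    rw [hr, sub_dotProduct, single_one_dotProduct, single_one_dotProduct, if_neg hv] at this
    exact sub_eq_zero.mp this

namespace IsTreeLineGraph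

variable {W P : Type*} [DecidableEq W] [DecidableEq P] {J : Bigraph W} {s t : W → P}

theorem ne (hJ : J.IsTreeLineGraph s t) (w : W) : s w ≠ t w := fun h => by
  obtain ⟨f, hf, -⟩ := hJ.cut w
  exact hf (congrArg f h)

theorem joins_ne (hJ : J.IsTreeLineGraph s t) {w : W} {p q : P} {σ : ℤ}
    (h : Joins s t w p q σ) : p ≠ q := by
  rcases h with ⟨-, rfl, rfl⟩ | ⟨-, rfl, rfl⟩
  · exact (hJ.ne w).symm
  · exact hJ.ne w

theorem cut_joins (hJ : J.IsTreeLineGraph s t) (w : W) :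
    ∃ f : P → ℤ, (∀ p q σ, Joins s t w p q σ → f p ≠ f q) ∧
      ∀ v, v ≠ w → ∀ p, IsEnd s t v p → f p = f (s v) := by
  obtain ⟨f, hf, hf'⟩ := hJ.cut w
  refine ⟨f, ?_, ?_⟩
  · rintro p q σ (⟨-, rfl, rfl⟩ | ⟨-, rfl, rfl⟩)
    · exact hf.symm
    · exact hf
  · rintro v hv p (rfl | rfl)
    · rfl
    · exact (hf' v hv).symm

/-- Two parallel edges would form a cycle: the cut at one of them separates ends that the other one
joins. -/
theorem eq_of_joins (hJ : J.IsTreeLineGraph s t) {v w : W} {p q : P} {σ τ : ℤ}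
    (hv : Joins s t v p q σ) (hw : Joins s t w p q τ) : v = w := by
  by_contra hne
  obtain ⟨f, hf, hf'⟩ := hJ.cut_joins w
  exact hf p q τ hw ((hf' v hne p hv.left).trans (hf' v hne q hv.right).symm)

/-- Without parallel edges, `q` is the only common end, so a single term of the inner product
survives. Traversing `v` and then `w`, equal directions give -1 (solid) and opposite ones give 1
(dotted). -/
theorem toMatrix_of_joins (hJ : J.IsTreeLineGraph s t) {v w : W} {p q c : P} {σ τ : ℤ}
    (hne : v ≠ w) (hv : Joins s t v p q σ) (hw : Joins s t w q c τ) :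
    J.toMatrix v w = -(σ * τ) := by
  have hpq := hJ.joins_ne hv
  have hqc := hJ.joins_ne hw
  have hpc : p ≠ c := by
    rintro rfl
    exact hne (hJ.eq_of_joins hv hw.symm)
  rw [hJ.entry v w hne]
  rcases hv with ⟨rfl, rfl, rfl⟩ | ⟨rfl, rfl, rfl⟩ <;>
    rcases hw with ⟨rfl, h, rfl⟩ | ⟨rfl, h, rfl⟩ <;>
    simp_all [eq_comm]

theorem adj_iff (hJ : J.IsTreeLineGraph s t) {v w : W} :
    J.graph.Adj v w ↔ v ≠ w ∧ ∃ p, IsEnd s t v p ∧ IsEnd s t w p := by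
  constructor
  · intro h
    refine ⟨h.ne, ?_⟩
    by_contra! hno
    have h0 := (J.adj_iff_toMatrix_ne_zero h.ne).mp h
    rw [hJ.entry v w h.ne] at h0
    have h1 := hno (s v) (Or.inl rfl)
    have h2 := hno (t v) (Or.inr rfl)
    simp only [IsEnd, not_or] at h1 h2
    simp [h1, h2] at h0
  · rintro ⟨hne, p, hv, hw⟩
    rw [J.adj_iff_toMatrix_ne_zero hne]
    obtain ⟨a, σ, hv⟩ := hv.exists_joins
    obtain ⟨b, τ, hw⟩ := hw.exists_joins
    rw [hJ.toMatrix_of_joins hne hv.symm hw]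
    rcases hv with ⟨rfl, -⟩ | ⟨rfl, -⟩ <;> rcases hw with ⟨rfl, -⟩ | ⟨rfl, -⟩ <;> norm_num

/-- A walk that avoids `w` stays on one side of the cut at `w`, because consecutive edges share a
point. -/
theorem walk_invariant (hJ : J.IsTreeLineGraph s t) {w : W} {f : P → ℤ}
    (hf : ∀ v, v ≠ w → ∀ p, IsEnd s t v p → f p = f (s v)) {x y : W} (q : J.graph.Walk x y)
    (hq : ∀ z ∈ q.support, z ≠ w) : f (s x) = f (s y) := by
  induction q with
  | nil => rfl
  | cons h q ih =>
    obtain ⟨-, p, hp, hp'⟩ := hJ.adj_iff.mp h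
    rw [← ih fun z hz => hq z (by simp [hz])]
    rw [← hf _ (hq _ (by simp)) p hp, ← hf _ (hq _ (by simp)) p hp']

/-- The indicator of the points touched by edges reachable from a fixed edge is constant along every
edge, hence constant by `conn`. -/
theorem connected (hJ : J.IsTreeLineGraph s t) [Nonempty W] : J.graph.Connected := by
  classical
  rw [SimpleGraph.connected_iff_exists_forall_reachable]
  obtain ⟨w⟩ := ‹Nonempty W›
  refine ⟨w, fun v => ?_⟩
  set f : P → ℤ := fun p => if ∃ x, J.graph.Reachable w x ∧ IsEnd s t x p then 1 else 0 with hfdef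
  have key : ∀ x p, f p = 1 → IsEnd s t x p → J.graph.Reachable w x := by
    intro x p hp hx
    simp only [hfdef, ite_eq_left_iff, zero_ne_one, imp_false, not_not] at hp
    obtain ⟨z, hz, hzp⟩ := hp
    by_cases hzx : z = x
    · exact hzx ▸ hz
    · exact hz.trans (hJ.adj_iff.mpr ⟨hzx, p, hzp, hx⟩).reachable
  have key' : ∀ x p, J.graph.Reachable w x → IsEnd s t x p → f p = 1 := fun x p h1 h2 =>
    if_pos ⟨x, h1, h2⟩
  have hconst := hJ.conn f fun x => by
    have h01 : ∀ p, f p = 1 ∨ f p = 0 := fun p => by simp only [hfdef]; split_ifs <;> simp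
    have hs := fun h => key' x (t x) (key x (s x) h (Or.inl rfl)) (Or.inr rfl)
    have ht := fun h => key' x (s x) (key x (t x) h (Or.inr rfl)) (Or.inl rfl)
    rcases h01 (s x) with h | h
    · rw [h, hs h]
    · rcases h01 (t x) with h' | h'
      · rw [h', ht h']
      · rw [h, h']
  exact key v (s v) ((hconst (s v) (s w)).trans (key' w (s w) .rfl (Or.inl rfl))) (Or.inl rfl)

end IsTreeLineGraph

end Bigraph

/-! ### Distances and vertex removal in simple graphs. -/

namespace SimpleGraph

variable {V : Type*} {G : SimpleGraph V}

theorem Walk.dist_lt_of_mem_support [DecidableEq V] {x y z : V} (p : G.Walk x y)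
    (hp : p.length = G.dist x y) (hz : z ∈ p.support) (hzx : z ≠ x) : G.dist z y < G.dist x y := by
  have h1 := congrArg Walk.length (p.take_spec hz)
  rw [Walk.length_append, hp] at h1
  have h2 := SimpleGraph.dist_le (p.dropUntil z hz)
  have h3 : (p.takeUntil z hz).length ≠ 0 := fun h => hzx (Walk.eq_of_length_eq_zero h).symm
  omega

theorem Walk.dist_le_of_mem_support [DecidableEq V] {x y z : V} (p : G.Walk x y)
    (hp : p.length = G.dist x y) (hz : z ∈ p.support) : G.dist z y ≤ G.dist x y := by
  by_cases h : z = x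
  · rw [h]
  · exact (p.dist_lt_of_mem_support hp hz h).le

theorem Connected.dist_le_of_adj (hG : G.Connected) {x z : V} (h : G.Adj x z) (y : V) :
    G.dist x y ≤ G.dist z y + 1 := by
  have h1 := hG.dist_triangle (u := x) (v := z) (w := y)
  rw [SimpleGraph.dist_eq_one_iff_adj.mpr h] at h1
  omega

/-- The tail of a shortest walk is a shortest walk. -/
theorem Connected.length_eq_dist_of_cons (hG : G.Connected) {x z y : V} {h : G.Adj x z}
    {p : G.Walk z y} (hp : (Walk.cons h p).length = G.dist x y) :
    p.length = G.dist z y ∧ G.dist x y = G.dist z y + 1 := by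
  have h1 := hG.dist_le_of_adj h y
  have h2 := SimpleGraph.dist_le p
  rw [Walk.length_cons] at hp
  omega

/-- If the neighbours of a vertex are pairwise adjacent, then its removal does not disconnect other
vertices. -/
theorem reachable_induce_compl_singleton {x : V}
    (h : ∀ a b, G.Adj x a → G.Adj x b → a ≠ b → G.Adj a b) (a b : ({x}ᶜ : Set V))
    (hab : G.Reachable a.1 b.1) : (G.induce ({x}ᶜ : Set V)).Reachable a b := by
  -- The second clause lets the induction bypass `x`: for a walk starting at `x`, any neighbour of
  -- `x` may serve as the start, since it equals or is adjacent to the next vertex.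
  have key : ∀ {c d : V} (_ : G.Walk c d) (hd : d ∈ ({x}ᶜ : Set V)),
      (∀ hc : c ∈ ({x}ᶜ : Set V), (G.induce ({x}ᶜ : Set V)).Reachable ⟨c, hc⟩ ⟨d, hd⟩) ∧
      (c = x → ∀ (e : V) (he : e ∈ ({x}ᶜ : Set V)), G.Adj x e →
        (G.induce ({x}ᶜ : Set V)).Reachable ⟨e, he⟩ ⟨d, hd⟩) := by
    intro c d q hd
    induction q with
    | nil => exact ⟨fun _ => .rfl, fun h => absurd h hd⟩
    | @cons c z d hcz q ih =>
      obtain ⟨ih1, ih2⟩ := ih hd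
      refine ⟨fun hc => ?_, ?_⟩
      · by_cases hz : z = x
        · exact ih2 hz c hc (hz ▸ hcz.symm)
        · have : (G.induce ({x}ᶜ : Set V)).Adj ⟨c, hc⟩ ⟨z, hz⟩ := hcz
          exact this.reachable.trans (ih1 hz)
      · rintro rfl e he hxe
        have hz : z ∈ ({c}ᶜ : Set V) := hcz.ne'
        by_cases hez : e = z
        · subst hez
          exact ih1 he
        · have : (G.induce ({c}ᶜ : Set V)).Adj ⟨e, he⟩ ⟨z, hz⟩ := h e z hxe hcz hez
          exact this.reachable.trans (ih1 hz)
  obtain ⟨q⟩ := hab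
  exact (key q b.2).1 a.2

end SimpleGraph

/-! ### Leaves, shortest paths and dotted edges in the line graph of a tree. -/

namespace Bigraph.IsTreeLineGraph

variable {W P : Type*} [DecidableEq W] [DecidableEq P] {J : Bigraph W} {s t : W → P}

/-- All neighbours of an edge ending in a leaf pass through its other end, so they are pairwise
adjacent. -/
theorem not_isSeparating (hJ : J.IsTreeLineGraph s t) {w : W} {p : P} (hp : IsEnd s t w p)
    (hleaf : ∀ v, v ≠ w → ¬ IsEnd s t v p) : ¬ J.IsSeparating w := by
  obtain ⟨q, σ, hw⟩ := hp.exists_joins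
  have hend : ∀ a, J.graph.Adj w a → IsEnd s t a q := by
    intro a ha
    obtain ⟨hne, c, hc, hc'⟩ := hJ.adj_iff.mp ha
    rcases hw.isEnd_iff.mp hc with rfl | rfl
    · exact absurd hc' (hleaf a hne.symm)
    · exact hc'
  rintro ⟨a, b, hab, hnot⟩
  refine hnot (SimpleGraph.reachable_induce_compl_singleton (fun c d hc hd hcd => ?_) a b hab)
  exact hJ.adj_iff.mpr ⟨hcd, q, hend c hc, hend d hd⟩

/-- If further edges `a` and `b` are attached at the two ends of `w`, they are connected through
`w`, but the cut at `w` separates them once `w` is removed. -/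
theorem exists_leaf (hJ : J.IsTreeLineGraph s t) {w : W} (h : ¬ J.IsSeparating w) :
    ∃ p q σ, Joins s t w p q σ ∧ ∀ v, v ≠ w → ¬ IsEnd s t v p := by
  by_contra! hno
  have h1 : Joins s t w (t w) (s w) 1 := Or.inl ⟨rfl, rfl, rfl⟩
  obtain ⟨a, ha, hat⟩ := hno _ _ _ h1
  obtain ⟨b, hb, hbs⟩ := hno _ _ _ h1.symm
  refine h ⟨⟨a, ha⟩, ⟨b, hb⟩, ?_, ?_⟩
  · exact (hJ.adj_iff.mpr ⟨ha, _, hat, h1.left⟩).reachable.trans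
      (hJ.adj_iff.mpr ⟨hb.symm, _, h1.right, hbs⟩).reachable
  · rintro ⟨q⟩
    obtain ⟨f, hf, hf'⟩ := hJ.cut_joins w
    have := hJ.walk_invariant hf' (q.map (SimpleGraph.Embedding.induce _).toHom) <| by
      intro z hz
      rw [SimpleGraph.Walk.support_map, List.mem_map] at hz
      obtain ⟨z', -, rfl⟩ := hz
      exact z'.2
    refine hf _ _ _ h1 ?_
    rw [hf' a ha _ hat, hf' b hb _ hbs]
    exact this

/-- In the line graph of a tree there is only one first step towards a given vertex. -/
theorem eq_of_adj_of_dist (hJ : J.IsTreeLineGraph s t) {x y w w' : W} (hw : J.graph.Adj x w)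
    (hw' : J.graph.Adj x w') (hd : J.graph.dist x y = J.graph.dist w y + 1)
    (hd' : J.graph.dist x y = J.graph.dist w' y + 1) : w = w' := by
  have : Nonempty W := ⟨x⟩
  have hconn := hJ.connected
  by_contra hne
  obtain ⟨q, hq⟩ := hconn.exists_walk_length_eq_dist w y
  obtain ⟨q', hq'⟩ := hconn.exists_walk_length_eq_dist w' y
  obtain ⟨-, p, hxp, hwp⟩ := hJ.adj_iff.mp hw
  obtain ⟨-, p', hxp', hwp'⟩ := hJ.adj_iff.mp hw'
  -- If both steps leave `x` through the same point `p`, use the cut at `w'`. The walk from `w`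
  -- avoids `w'`, and the walk from `w'` continues through its other end, as an edge through `p`
  -- would be too close to `x`; so both ends of `w'` get the same value. If the points differ, the
  -- cut at `x` separates them although both walks avoid `x`.
  by_cases hpp : p = p'
  · subst hpp
    obtain ⟨f, hf, hf'⟩ := hJ.cut_joins w'
    have h1 := hJ.walk_invariant hf' q fun z hz hzw => by
      have := q.dist_lt_of_mem_support hq hz (hzw ▸ Ne.symm hne)
      rw [hzw] at this
      omega
    cases q' with
    | nil =>
      rw [SimpleGraph.dist_self] at hd'
      exact hne (hconn.dist_eq_zero_iff.mp (by omega))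
    | @cons _ v _ h q' =>
      obtain ⟨hq', hdv⟩ := hconn.length_eq_dist_of_cons hq'
      have h2 := hJ.walk_invariant hf' q' fun z hz hzw => by
        have := q'.dist_le_of_mem_support hq' hz
        rw [hzw] at this
        omega
      obtain ⟨hne', c, hc, hc'⟩ := hJ.adj_iff.mp h
      obtain ⟨d, σ, hj⟩ := hwp'.exists_joins
      rcases hj.isEnd_iff.mp hc with rfl | rfl
      · by_cases hxv : x = v
        · subst hxv
          omega
        · have := hconn.dist_le_of_adj (hJ.adj_iff.mpr ⟨hxv, c, hxp, hc'⟩) y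
          omega
      · refine hf _ _ _ hj ?_
        rw [hf' w hne _ hwp, h1, ← h2, hf' v hne'.symm _ hc']
  · obtain ⟨f, hf, hf'⟩ := hJ.cut_joins x
    have h1 := hJ.walk_invariant hf' q fun z hz hzx => by
      have := q.dist_le_of_mem_support hq hz
      rw [hzx] at this
      omega
    have h2 := hJ.walk_invariant hf' q' fun z hz hzx => by
      have := q'.dist_le_of_mem_support hq' hz
      rw [hzx] at this
      omega
    obtain ⟨c, σ, hj⟩ := hxp.exists_joins
    obtain rfl : p' = c := (hj.isEnd_iff.mp hxp').resolve_left (Ne.symm hpp)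
    refine hf _ _ _ hj ?_
    rw [hf' w hw.ne' _ hwp, hf' w' hw'.ne' _ hwp', h1, h2]

theorem walk_unique (hJ : J.IsTreeLineGraph s t) {x y : W} (p q : J.graph.Walk x y)
    (hp : p.length = J.graph.dist x y) (hq : q.length = J.graph.dist x y) : p = q := by
  have : Nonempty W := ⟨x⟩
  have hconn := hJ.connected
  induction p with
  | nil =>
    cases q with
    | nil => rfl
    | cons h q => simp at hq
  | cons h p ih =>
    cases q with
    | nil => simp at hp
    | cons h' q =>
      obtain ⟨hp1, hp2⟩ := hconn.length_eq_dist_of_cons hp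
      obtain ⟨hq1, hq2⟩ := hconn.length_eq_dist_of_cons hq
      obtain rfl := hJ.eq_of_adj_of_dist h h' hp2 hq2
      rw [ih q hp1 hq1]

theorem existsUnique_isShortestPath (hJ : J.IsTreeLineGraph s t) (x y : W) :
    ∃! p : J.graph.Walk x y, J.IsShortestPath p := by
  have : Nonempty W := ⟨x⟩
  obtain ⟨p, hp⟩ := hJ.connected.exists_walk_length_eq_dist x y
  exact ⟨p, ⟨p.isPath_of_length_eq_dist hp, hp⟩, fun q hq => hJ.walk_unique q p hq.2 hp⟩

/-- Along a shortest path the orientation of the edges of the tree, relative to the direction of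
the path, changes exactly at the dotted edges. -/
theorem neg_one_pow_numDotted (hJ : J.IsTreeLineGraph s t) {x y : W} (p : J.graph.Walk x y)
    (hp : p.length = J.graph.dist x y) {a b : P} {σ : ℤ} (hx : Joins s t x a b σ)
    (hleaf : ∀ w ∈ p.support, w ≠ x → ¬ IsEnd s t w a) :
    ∃ c d τ, Joins s t y c d τ ∧ (-1 : ℤ) ^ J.numDotted p = σ * τ ∧
      (p.length = 0 → c = a) ∧ (p.length ≠ 0 → ∃ w, w ≠ y ∧ IsEnd s t w c) := by
  have : Nonempty W := ⟨x⟩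
  have hconn := hJ.connected
  induction p generalizing a b σ with
  | nil => exact ⟨a, b, σ, hx, by simp [numDotted, hx.mul_self], by simp⟩
  | @cons x z y h p ih =>
    obtain ⟨hp1, hp2⟩ := hconn.length_eq_dist_of_cons hp
    have hz : IsEnd s t z b := by
      obtain ⟨hne, e, he, he'⟩ := hJ.adj_iff.mp h
      rcases hx.isEnd_iff.mp he with rfl | rfl
      · exact absurd he' (hleaf z (by simp) hne.symm)
      · exact he'
    obtain ⟨c, σ', hj⟩ := hz.exists_joins
    -- The tail never returns to `b`: a later edge through `b` would equal or be adjacent to `x`,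
    -- yet it is closer to `y` than `z` is.
    obtain ⟨c', d, τ, hy, hnum, hzero, hlen⟩ := ih hp1 hj fun w hw hwz hwb => by
      have hlt := p.dist_lt_of_mem_support hp1 hw hwz
      by_cases hxw : x = w
      · subst hxw
        omega
      · have := hconn.dist_le_of_adj (hJ.adj_iff.mpr ⟨hxw, b, hx.right, hwb⟩) y
        omega
    refine ⟨c', d, τ, hy, ?_, by simp, fun _ => ?_⟩
    · have hcount : J.numDotted (SimpleGraph.Walk.cons h p) =
          J.numDotted p + if 0 < J.dotted x z then 1 else 0 := by
        simp [numDotted, List.countP_cons]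
      have hsign : (-1 : ℤ) ^ (if 0 < J.dotted x z then 1 else 0) = σ * σ' := by
        simp only [J.dotted_pos_iff h.ne, hJ.toMatrix_of_joins h.ne hx hj]
        rcases hx with ⟨rfl, -⟩ | ⟨rfl, -⟩ <;> rcases hj with ⟨rfl, -⟩ | ⟨rfl, -⟩ <;> norm_num
      rw [hcount, pow_add, hnum, hsign]
      linear_combination (σ * τ) * hj.mul_self
    · by_cases h0 : p.length = 0
      · obtain rfl := SimpleGraph.Walk.eq_of_length_eq_zero h0
        exact ⟨x, h.ne, hzero h0 ▸ hx.right⟩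
      · exact hlen h0

/-- For two edges ending in leaves of the tree, the number of dotted edges on the shortest path is
odd if and only if they are both oriented towards, or both away from, their leaves. -/
theorem odd_numDotted_iff (hJ : J.IsTreeLineGraph s t) {x y : W} (hxy : x ≠ y)
    {p : J.graph.Walk x y} (hp : J.IsShortestPath p) {a b a' b' : P} {σ τ : ℤ}
    (hx : Joins s t x a b σ) (ha : ∀ w, w ≠ x → ¬ IsEnd s t w a)
    (hy : Joins s t y a' b' τ) (ha' : ∀ w, w ≠ y → ¬ IsEnd s t w a') :
    Odd (J.numDotted p) ↔ σ = τ := by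
  obtain ⟨c, d, τ', hc, hpow, -, hlen⟩ := hJ.neg_one_pow_numDotted p hp.2 hx fun w _ => ha w
  obtain ⟨w, hw, hwc⟩ := hlen fun h => hxy (SimpleGraph.Walk.eq_of_length_eq_zero h)
  have hca : c ≠ a' := fun h => ha' w hw (h ▸ hwc)
  have hab := hJ.joins_ne hy
  -- The path enters `y` at the end other than the leaf, so the sign of `y` relative to the path is
  -- opposite to its sign relative to the leaf.
  have hττ : τ' = -τ := by
    rcases hc with ⟨rfl, rfl, rfl⟩ | ⟨rfl, rfl, rfl⟩ <;>
      rcases hy with ⟨rfl, rfl, rfl⟩ | ⟨rfl, rfl, rfl⟩ <;> simp_all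
  rw [hττ] at hpow
  have hσ : σ = 1 ∨ σ = -1 := hx.imp And.left And.left
  have hτ : τ = 1 ∨ τ = -1 := hy.imp And.left And.left
  rcases Nat.even_or_odd (J.numDotted p) with h | h
  · rw [h.neg_one_pow] at hpow
    refine iff_of_false (Nat.not_odd_iff_even.mpr h) ?_
    rintro rfl
    rcases hσ with rfl | rfl <;> norm_num at hpow
  · rw [h.neg_one_pow] at hpow
    refine iff_of_true h ?_
    rcases hσ with rfl | rfl <;> rcases hτ with rfl | rfl <;> first | rfl | norm_num at hpow

end Bigraph.IsTreeLineGraph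

/-! ### Isomorphisms and identification in terms of vectors. -/

namespace Bigraph

section Isomorphism

variable {V W : Type*} [DecidableEq V] [DecidableEq W]

theorem toMatrix_self (G : Bigraph V) (v : V) : G.toMatrix v v = 2 := by simp [toMatrix]

theorem Isomorphic.exists_toMatrix_eq {G : Bigraph V} {H : Bigraph W} (h : G.Isomorphic H) :
    ∃ e : V ≃ W, ∀ v w, G.toMatrix v w = H.toMatrix (e v) (e w) := by
  obtain ⟨e, he⟩ := h
  refine ⟨e, fun v w => ?_⟩
  simp [toMatrix, (he v w).1, (he v w).2]

theorem isomorphic_of_toMatrix_eq {G : Bigraph V} {H : Bigraph W} (e : V ≃ W)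
    (h : ∀ v w, v ≠ w → G.toMatrix v w = H.toMatrix (e v) (e w)) : G.Isomorphic H := by
  refine ⟨e, fun v w => ?_⟩
  by_cases hvw : v = w
  · subst hvw
    simp [solid_loopless, dotted_loopless]
  · have h1 := h v w hvw
    have h2 := G.same_style v w
    have h3 := H.same_style (e v) (e w)
    simp only [toMatrix, Matrix.of_apply, if_neg hvw, EmbeddingLike.apply_eq_iff_eq] at h1
    omega

theorem Isomorphic.isRealizedBy {P : Type*} [Fintype P] {G : Bigraph V} {H : Bigraph W}
    (h : G.Isomorphic H) {r : W → P → ℤ} {L : Submodule ℤ (P → ℤ)} (hr : H.IsRealizedBy r L) :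
    ∃ r' : V → P → ℤ, G.IsRealizedBy r' L := by
  obtain ⟨e, he⟩ := h.exists_toMatrix_eq
  refine ⟨r ∘ e, fun v w => by rw [he, hr.gram]; rfl, ?_⟩
  rw [e.surjective.range_comp, hr.span]

/-- Cancelling opposite pairs preserves the number of dotted minus solid edges, so off-diagonal
entries add up over the fibres despite the truncated subtractions. -/
theorem toMatrix_identify (G : Bigraph V) (x y : V) (h : ¬ G.graph.Adj x y) {a b : IdVertex x y}
    (hab : a ≠ b) : (G.identify x y h).toMatrix a b =
      ∑ i ∈ idFiber x y a, ∑ j ∈ idFiber x y b, G.toMatrix i j := by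
  have hne : ∀ i ∈ idFiber x y a, ∀ j ∈ idFiber x y b, i ≠ j := by
    rintro i hi j hj rfl
    rcases a with _ | ⟨a, ha⟩ <;> rcases b with _ | ⟨b, hb⟩ <;>
      simp only [idFiber, Finset.mem_insert, Finset.mem_singleton] at hi hj <;> simp_all
  have hsum : ∑ i ∈ idFiber x y a, ∑ j ∈ idFiber x y b, G.toMatrix i j =
      (idCount x y G.dotted a b : ℤ) - idCount x y G.solid a b := by
    simp only [idCount, Nat.cast_sum, ← Finset.sum_sub_distrib]
    refine Finset.sum_congr rfl fun i hi => Finset.sum_congr rfl fun j hj => ?_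
    simp [toMatrix, hne i hi j hj]
  rw [hsum]
  simp only [toMatrix, Matrix.of_apply, if_neg hab, identify]
  omega

/-- The sum of the vectors assigned to the vertices that become the vertex `a`. -/
def fiberSum {P : Type*} (x y : V) (r : V → P → ℤ) (a : IdVertex x y) : P → ℤ :=
  ∑ i ∈ idFiber x y a, r i

theorem fiberSum_none {P : Type*} {x y : V} (hxy : x ≠ y) (r : V → P → ℤ) :
    fiberSum x y r none = r x + r y := by
  simp [fiberSum, idFiber, hxy]

theorem fiberSum_some {P : Type*} {x y : V} (r : V → P → ℤ) (w : {w : V // w ≠ x ∧ w ≠ y}) :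
    fiberSum x y r (some w) = r w.1 := by
  simp [fiberSum, idFiber]

theorem IsRealizedBy.toMatrix_identify {P : Type*} [Fintype P] {G : Bigraph V} {r : V → P → ℤ}
    {L : Submodule ℤ (P → ℤ)} (hr : G.IsRealizedBy r L) (x y : V) (h : ¬ G.graph.Adj x y)
    {a b : IdVertex x y} (hab : a ≠ b) : (G.identify x y h).toMatrix a b =
      fiberSum x y r a ⬝ᵥ fiberSum x y r b := by
  rw [G.toMatrix_identify x y h hab, fiberSum, fiberSum, sum_dotProduct]
  simp only [dotProduct_sum, hr.gram]

end Isomorphism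

theorem sum_eq_add_add_sum_subtype {P : Type*} [Fintype P] [DecidableEq P] {p q : P} (hpq : p ≠ q)
    (g : P → ℤ) : ∑ i, g i = g p + g q + ∑ i : {i // i ≠ p ∧ i ≠ q}, g i := by
  rw [← Finset.add_sum_erase _ _ (Finset.mem_univ p),
    ← Finset.add_sum_erase _ _ (Finset.mem_erase.mpr ⟨hpq.symm, Finset.mem_univ q⟩), add_assoc]
  congr 2
  refine (Finset.sum_subtype _ (fun i => ?_) g)
  simp [and_comm]

/-! ### Folding: from type A to type D. -/

section Folding

variable {W P : Type*} [Fintype W] [DecidableEq W] [Fintype P] [DecidableEq P]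

/-- Identifying two edges with leaves `p` and `p'` that are both oriented towards, or both away
from, their leaves produces a basis of the lattice of vectors with even coordinate sum. -/
theorem IsRealizedBy.identify {J : Bigraph W} {r : W → P → ℤ}
    (hr : J.IsRealizedBy r (sumZeroLattice P)) {x y : W} (hxy : x ≠ y) (h : ¬ J.graph.Adj x y)
    {p q p' q' : P} {σ : ℤ} (hσ : σ * σ = 1) (hqp : q ≠ p) (hqp' : q ≠ p') (hq'p : q' ≠ p)
    (hq'p' : q' ≠ p') (hpp' : p ≠ p')
    (hx : r x = σ • (Pi.single q 1 - Pi.single p 1))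
    (hy : r y = σ • (Pi.single q' 1 - Pi.single p' 1))
    (hp : ∀ w, w ≠ x → r w p = 0) (hp' : ∀ w, w ≠ y → r w p' = 0) :
    (J.identify x y h).IsRealizedBy
      (fun a (i : {i // i ≠ p ∧ i ≠ p'}) => fiberSum x y r a i) (evenSumLattice _) := by
  have hxp : r x p = -σ := by simp [hx, hqp.symm]
  have hyp' : r y p' = -σ := by simp [hy, hq'p'.symm]
  have hRnp : fiberSum x y r none p = -σ := by
    simp [fiberSum_none hxy, hxp, hp y hxy.symm]
  have hRnp' : fiberSum x y r none p' = -σ := by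
    simp [fiberSum_none hxy, hyp', hp' x hxy]
  have hRsp : ∀ w, fiberSum x y r (some w) p = 0 := fun w => by
    rw [fiberSum_some, hp _ w.2.1]
  have hRsp' : ∀ w, fiberSum x y r (some w) p' = 0 := fun w => by
    rw [fiberSum_some, hp' _ w.2.2]
  have hdot : ∀ a b, (fun i : {i // i ≠ p ∧ i ≠ p'} => fiberSum x y r a i) ⬝ᵥ
      (fun i => fiberSum x y r b i) = fiberSum x y r a ⬝ᵥ fiberSum x y r b -
        (fiberSum x y r a p * fiberSum x y r b p + fiberSum x y r a p' * fiberSum x y r b p') := by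
    intro a b
    simp only [dotProduct]
    rw [sum_eq_add_add_sum_subtype hpp']
    ring
  refine ⟨fun a b => ?_, le_antisymm ?_ ?_⟩
  · rw [hdot]
    by_cases hab : a = b
    · subst hab
      rw [toMatrix_self]
      cases a with
      | none =>
        -- Nonadjacent vertices have orthogonal vectors, so the sum has squared length 4; the
        -- deleted coordinates account for σ² + σ² = 2 of it.
        have h0 : r x ⬝ᵥ r y = 0 := by
          rw [← hr.gram]
          by_contra h0
          exact h ((J.adj_iff_toMatrix_ne_zero hxy).mpr h0)
        rw [hRnp, hRnp', fiberSum_none hxy, dotProduct_add, add_dotProduct, add_dotProduct,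
          dotProduct_comm (r y) (r x), h0, ← hr.gram, ← hr.gram, toMatrix_self, toMatrix_self]
        linear_combination 2 * hσ
      | some w =>
        rw [hRsp, hRsp', fiberSum_some, ← hr.gram, toMatrix_self]
        norm_num
    · rw [hr.toMatrix_identify x y h hab]
      -- Only the merged vertex uses the deleted coordinates, so products of different vertices do
      -- not notice the deletion.
      have h1 : fiberSum x y r a p * fiberSum x y r b p = 0 := by
        rcases a with _ | a
        · rcases b with _ | b
          · exact absurd rfl hab
          · rw [hRsp b, mul_zero]
        · rw [hRsp a, zero_mul]
      have h2 : fiberSum x y r a p' * fiberSum x y r b p' = 0 := by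
        rcases a with _ | a
        · rcases b with _ | b
          · exact absurd rfl hab
          · rw [hRsp' b, mul_zero]
        · rw [hRsp' a, zero_mul]
      rw [h1, h2]
      ring
  · rw [Submodule.span_le]
    rintro _ ⟨a, rfl⟩
    have h1 := sum_eq_add_add_sum_subtype hpp' (fiberSum x y r a)
    have h0 : ∑ i, fiberSum x y r a i = 0 :=
      mem_sumZeroLattice.mp (Submodule.sum_mem _ fun i _ => hr.mem i)
    rw [SetLike.mem_coe, mem_evenSumLattice]
    rw [h0] at h1
    cases a with
    | none =>
      rw [hRnp, hRnp'] at h1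
      exact ⟨σ, by linarith⟩
    | some w =>
      rw [hRsp, hRsp'] at h1
      exact ⟨0, by linarith⟩
  · refine evenSumLattice_le (sumZeroLattice_le ⟨q, hqp, hqp'⟩ fun i => ?_) ⟨q, hqp, hqp'⟩
      ⟨q', hq'p, hq'p'⟩ ?_
    · have hi := single_sub_single_mem_sumZeroLattice (P := P) i.1 q
      rw [← hr.span, Submodule.mem_span_range_iff_exists_fun] at hi
      obtain ⟨c, hc⟩ := hi
      -- Among the vectors `r w` only `r x` has a nonzero entry at the leaf `p`, where e_i - e_q
      -- vanishes. So the combination uses neither `x` nor, likewise, `y`, and survives the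
      -- identification.
      have hcx : c x = 0 := by
        have := congrFun hc p
        rw [Finset.sum_apply, Finset.sum_eq_single x (fun w _ hw => by simp [hp w hw])
          (fun h => absurd (Finset.mem_univ _) h)] at this
        simp only [Pi.smul_apply, hxp, Pi.sub_apply, Pi.single_apply, if_neg hqp.symm,
          if_neg i.2.1.symm, smul_eq_mul] at this
        linear_combination (-σ) * this - c x * hσ
      have hcy : c y = 0 := by
        have := congrFun hc p'
        rw [Finset.sum_apply, Finset.sum_eq_single y (fun w _ hw => by simp [hp' w hw])
          (fun h => absurd (Finset.mem_univ _) h)] at this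
        simp only [Pi.smul_apply, hyp', Pi.sub_apply, Pi.single_apply, if_neg hqp'.symm,
          if_neg i.2.2.symm, smul_eq_mul] at this
        linear_combination (-σ) * this - c y * hσ
      have hsum : (Pi.single i 1 - Pi.single ⟨q, hqp, hqp'⟩ 1 : {i // i ≠ p ∧ i ≠ p'} → ℤ) =
          ∑ w, c w • fun i : {i // i ≠ p ∧ i ≠ p'} => r w i := by
        ext k
        have := congrFun hc k
        simp only [Finset.sum_apply, Pi.smul_apply, Pi.sub_apply, Pi.single_apply] at this ⊢
        rw [this]
        simp only [Subtype.ext_iff]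
      rw [hsum]
      refine Submodule.sum_mem _ fun w _ => ?_
      by_cases hwx : w = x
      · simp [hwx, hcx]
      by_cases hwy : w = y
      · simp [hwy, hcy]
      exact Submodule.smul_mem _ _ (Submodule.subset_span ⟨some ⟨w, hwx, hwy⟩, by
        simp only [fiberSum_some]⟩)
    · have : (Pi.single ⟨q, hqp, hqp'⟩ 1 + Pi.single ⟨q', hq'p, hq'p'⟩ 1 :
          {i // i ≠ p ∧ i ≠ p'} → ℤ) = σ • fun i : {i // i ≠ p ∧ i ≠ p'} => fiberSum x y r none i := by
        ext k
        have h1 := k.2.1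
        have h2 := k.2.2
        simp only [fiberSum_none hxy, Pi.smul_apply, Pi.add_apply, hx, hy, Pi.sub_apply,
          Pi.single_apply, Subtype.ext_iff, if_neg h1, if_neg h2, smul_eq_mul]
        linear_combination (-(if k.1 = q then 1 else 0) - (if k.1 = q' then 1 else 0) : ℤ) * hσ
      rw [this]
      exact Submodule.smul_mem _ _ (Submodule.subset_span ⟨none, rfl⟩)

end Folding

/-- Non-separation supplies the two leaves and the odd number of dotted edges the common sign, which
is what folding needs; deleting the leaves from n + 2 points leaves n coordinates. -/
theorem hasDynkinType_D_of_isomorphic_identify {n : ℕ} (hn : 3 ≤ n) {V W : Type*} [Fintype V]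
    [DecidableEq V] [Fintype W] [DecidableEq W] {G : Bigraph V} (hV : Fintype.card V = n)
    {J : Bigraph W} (hJ : J.HasDynkinType (CartanMatrix.A (n + 1))) {x y : W}
    (hx : ¬ J.IsSeparating x) (hy : ¬ J.IsSeparating y) (hd : 2 ≤ J.graph.dist x y)
    {p : J.graph.Walk x y} (hp : J.IsShortestPath p) (hodd : Odd (J.numDotted p))
    (hG : G.Isomorphic (J.identify x y (J.not_adj_of_two_le_dist hd))) :
    G.HasDynkinType (CartanMatrix.D n) := by
  obtain ⟨r, hr⟩ := hJ.exists_isRealizedBy_sumZeroLattice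
  obtain ⟨s, t, hst, hT⟩ := hr.exists_isTreeLineGraph (by simp [hJ.card_eq])
  have hadj := J.not_adj_of_two_le_dist hd
  have hxy : x ≠ y := by
    rintro rfl
    simp at hd
  obtain ⟨a, b, σ, hjx, hxa⟩ := hT.exists_leaf hx
  obtain ⟨a', b', τ, hjy, hya'⟩ := hT.exists_leaf hy
  obtain rfl := (hT.odd_numDotted_iff hxy hp hjx hxa hjy hya').mp hodd
  have hzero : ∀ w c, ¬ IsEnd s t w c → r w c = 0 := fun w c hc => by
    simp only [IsEnd, not_or] at hc
    simp [hst, hc.1, hc.2]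
  have haa' : a ≠ a' := fun h => hya' x hxy (h ▸ hjx.left)
  have hba' : b ≠ a' := fun h => hya' x hxy (h ▸ hjx.right)
  have hb'a : b' ≠ a := fun h => hxa y hxy.symm (h ▸ hjy.right)
  have hR := hr.identify hxy hadj hjx.mul_self (hT.joins_ne hjx).symm
    hba' hb'a (hT.joins_ne hjy).symm haa' ((hst x).trans hjx.sub_eq)
    ((hst y).trans hjy.sub_eq) (fun w hw => hzero w _ (hxa w hw))
    (fun w hw => hzero w _ (hya' w hw))
  obtain ⟨r', hr'⟩ := hG.isRealizedBy hR
  refine hr'.hasDynkinType_D hn hV ?_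
  have hcard := sum_eq_add_add_sum_subtype haa' fun _ => 1
  simp only [Finset.sum_const, Finset.card_univ, Fintype.card_fin, nsmul_eq_mul]
    at hcard
  push_cast at hcard
  omega

/-! ### Switching signs of coordinates in the even-sum lattice. -/

section Switching

variable {V P : Type*} [DecidableEq V] [Fintype P]

/-- A sign change of coordinates is an isometry, and it preserves the parity of the coordinate sum.
-/
theorem IsRealizedBy.switch {G : Bigraph V} {r : V → P → ℤ}
    (hr : G.IsRealizedBy r (evenSumLattice P)) {ε : P → ℤ} (hε : ∀ i, ε i * ε i = 1) :
    G.IsRealizedBy (fun v => ε * r v) (evenSumLattice P) where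
  gram v w := by
    rw [hr.gram, dotProduct, dotProduct]
    refine Finset.sum_congr rfl fun i _ => ?_
    simp only [Pi.mul_apply]
    linear_combination (-(r v i * r w i)) * hε i
  span := by
    have hmem : ∀ x ∈ evenSumLattice P, ε * x ∈ evenSumLattice P := by
      intro x hx
      rw [mem_evenSumLattice] at hx ⊢
      have h1 : ∀ i, Even ((ε * x) i - x i) := by
        intro i
        rcases mul_self_eq_one_iff.mp (hε i) with h | h
        · simp [h]
        · exact ⟨-x i, by simp [h]; ring⟩
      have h2 : Even (∑ i, ((ε * x) i - x i)) := Finset.even_sum _ fun i _ => h1 i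
      rw [Finset.sum_sub_distrib] at h2
      simpa using h2.add hx
    have hcomp : (fun v => ε * r v) = LinearMap.mulLeft ℤ ε ∘ r := rfl
    rw [hcomp, Set.range_comp, ← Submodule.map_span, hr.span]
    ext x
    rw [Submodule.mem_map]
    constructor
    · rintro ⟨y, hy, rfl⟩
      exact hmem y hy
    · intro hx
      refine ⟨ε * x, hmem x hx, ?_⟩
      ext i
      simp only [LinearMap.mulLeft_apply, Pi.mul_apply]
      linear_combination x i * hε i

variable [DecidableEq P]

/-- In a basis of the lattice of vectors with even coordinate sum, the supports of the basis vectors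
connect the coordinates. -/
theorem IsRealizedBy.exists_crossing {G : Bigraph V} {r : V → P → ℤ}
    (hr : G.IsRealizedBy r (evenSumLattice P)) {S : Finset P} {a b : P} (ha : a ∈ S)
    (hb : b ∉ S) : ∃ v, ∃ i ∈ S, ∃ j, j ∉ S ∧ r v i ≠ 0 ∧ r v j ≠ 0 := by
  by_contra! hno
  -- If every support lies inside or outside `S`, the partial sum over `S` is even on all
  -- generators, hence on the lattice; but it equals 1 on e_a + e_b.
  have heven : ∀ v, Even (∑ i ∈ S, r v i) := by
    intro v
    by_cases h : ∃ i ∈ S, r v i ≠ 0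
    · obtain ⟨i, hi, hvi⟩ := h
      have h1 := mem_evenSumLattice.mp (hr.mem v)
      rwa [← Finset.sum_subset (Finset.subset_univ S) fun j _ hj => hno v i hi j hj hvi] at h1
    · push Not at h
      rw [Finset.sum_eq_zero h]
      exact Even.zero
  have hspan : ∀ x ∈ evenSumLattice P, Even (∑ i ∈ S, x i) := by
    intro x hx
    rw [← hr.span] at hx
    induction hx using Submodule.span_induction with
    | mem x hx =>
      obtain ⟨v, rfl⟩ := hx
      exact heven v
    | zero => simp
    | add x y _ _ hx hy => simpa [Finset.sum_add_distrib] using hx.add hy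
    | smul c x _ hx => simpa [← Finset.mul_sum] using hx.mul_left c
  have := hspan _ (single_add_single_mem_evenSumLattice a b)
  simp [Finset.sum_add_distrib, Finset.sum_pi_single', ha, hb] at this

/-- A partial spanning tree, together with a switching of the coordinates for which its vectors have
coordinate sum zero. -/
theorem IsRealizedBy.exists_partial_switching {G : Bigraph V} {r : V → P → ℤ}
    (hr : G.IsRealizedBy r (evenSumLattice P)) (p : P) (k : ℕ) (hk : k + 1 ≤ Fintype.card P) :
    ∃ (S : Finset P) (F : Finset V) (ε : P → ℤ), p ∈ S ∧ S.card = k + 1 ∧ F.card = k ∧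
      (∀ i, ε i * ε i = 1) ∧ ∀ v ∈ F, ∑ i, ε i * r v i = 0 ∧ ∀ i, i ∉ S → r v i = 0 := by
  induction k with
  | zero => exact ⟨{p}, ∅, fun _ => 1, by simp, by simp, by simp, by simp, by simp⟩
  | succ k ih =>
    obtain ⟨S, F, ε, hpS, hS, hF, hε, hSF⟩ := ih (by omega)
    obtain ⟨q, hq⟩ : ∃ q, q ∉ S := by
      by_contra! hall
      rw [Finset.eq_univ_iff_forall.mpr hall, Finset.card_univ] at hS
      omega
    obtain ⟨v, i, hi, j, hj, hvi, hvj⟩ := hr.exists_crossing hpS hq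
    have hij : i ≠ j := fun h => hj (h ▸ hi)
    obtain ⟨σ, τ, hσ, hτ, hv⟩ : ∃ σ τ : ℤ, (σ = 1 ∨ σ = -1) ∧ (τ = 1 ∨ τ = -1) ∧
        r v = Pi.single i σ + Pi.single j τ := by
      obtain ⟨i', j', hij', σ, τ, hσ, hτ, hv⟩ :=
        exists_eq_single_add_single (x := r v) (by rw [← hr.gram, toMatrix_self])
      have h1 : ∀ m, r v m ≠ 0 → m = i' ∨ m = j' := by
        intro m hm
        by_contra! h
        exact hm (by rw [hv]; simp [h.1, h.2])
      rcases h1 i hvi with rfl | rfl <;> rcases h1 j hvj with rfl | rfl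
      · exact absurd rfl hij
      · exact ⟨σ, τ, hσ, hτ, hv⟩
      · exact ⟨τ, σ, hτ, hσ, by rw [hv, add_comm]⟩
      · exact absurd rfl hij
    have hσσ : σ * σ = 1 := by rcases hσ with rfl | rfl <;> norm_num
    have hττ : τ * τ = 1 := by rcases hτ with rfl | rfl <;> norm_num
    -- The new sign at `j` solves ε_i σ + ε_j τ = 0. The earlier vectors vanish at `j`, so they are
    -- unaffected, and `v` is new because it does not vanish there.
    refine ⟨insert j S, insert v F, Function.update ε j (-(σ * τ * ε i)),
      Finset.mem_insert_of_mem hpS, by rw [Finset.card_insert_of_notMem hj, hS],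
      by rw [Finset.card_insert_of_notMem fun h => hvj ((hSF v h).2 j hj), hF], fun m => ?_,
      fun w hw => ?_⟩
    · by_cases hm : m = j
      · subst hm
        rw [Function.update_self]
        linear_combination (σ * σ * τ * τ) * hε i + (τ * τ) * hσσ + hττ
      · rw [Function.update_of_ne hm, hε]
    · rw [Finset.mem_insert] at hw
      rcases hw with rfl | hw
      · constructor
        · simp only [hv, Pi.add_apply, mul_add, Finset.sum_add_distrib, Pi.single_apply, mul_ite,
            mul_zero, Finset.sum_ite_eq', Finset.mem_univ, if_true, Function.update_self,
            Function.update_of_ne hij]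
          linear_combination (-(σ * ε i)) * hττ
        · intro m hm
          rw [Finset.mem_insert, not_or] at hm
          have hmi : m ≠ i := fun h => hm.2 (h ▸ hi)
          simp [hv, hm.1, hmi]
      · obtain ⟨h1, h2⟩ := hSF w hw
        refine ⟨?_, fun m hm => h2 m fun h => hm (Finset.mem_insert_of_mem h)⟩
        rw [← h1]
        refine Finset.sum_congr rfl fun m _ => ?_
        by_cases hm : m = j
        · rw [hm, h2 j hj, mul_zero, mul_zero]
        · rw [Function.update_of_ne hm]

/-- Up to switching, a basis of the lattice of vectors with even coordinate sum consists of the edges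
of a tree and one additional vector. -/
theorem IsRealizedBy.exists_switching [Fintype V] {G : Bigraph V} {r : V → P → ℤ}
    (hr : G.IsRealizedBy r (evenSumLattice P)) (hcard : Fintype.card V = Fintype.card P)
    (hP : 0 < Fintype.card P) :
    ∃ ρ : V → P → ℤ, G.IsRealizedBy ρ (evenSumLattice P) ∧ ∃ (c : V) (a b : P) (σ : ℤ),
      a ≠ b ∧ (σ = 1 ∨ σ = -1) ∧ ρ c = σ • (Pi.single a 1 + Pi.single b 1) ∧
      ∀ v, v ≠ c → ∑ i, ρ v i = 0 := by
  obtain ⟨p⟩ := Fintype.card_pos_iff.mp hP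
  obtain ⟨S, F, ε, -, -, hF, hε, hSF⟩ :=
    hr.exists_partial_switching p (Fintype.card P - 1) (by omega)
  have hρ := hr.switch hε
  obtain ⟨c, hc⟩ : ∃ c, Fᶜ = {c} := by
    rw [← Finset.card_eq_one, Finset.card_compl]
    omega
  have hsum : ∀ v, v ≠ c → ∑ i, (ε * r v) i = 0 := by
    intro v hv
    refine (hSF v ?_).1
    by_contra hvF
    rw [← Finset.mem_compl, hc, Finset.mem_singleton] at hvF
    exact hv hvF
  -- Otherwise the whole lattice would have coordinate sum zero, contrary to 2e_p. Hence the two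
  -- entries ±1 of the last vector are equal.
  have hcne : ∑ i, (ε * r c) i ≠ 0 := by
    intro h0
    have hle : evenSumLattice P ≤ sumZeroLattice P := by
      rw [← hρ.span, Submodule.span_le]
      rintro _ ⟨v, rfl⟩
      by_cases hv : v = c
      · exact hv ▸ h0
      · exact hsum v hv
    have := mem_sumZeroLattice.mp (hle (single_add_single_mem_evenSumLattice p p))
    simp [Finset.sum_add_distrib] at this
  obtain ⟨a, b, hab, σ, τ, hσ, hτ, hx⟩ :=
    exists_eq_single_add_single (x := ε * r c) (by rw [← hρ.gram, toMatrix_self])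
  refine ⟨_, hρ, c, a, b, σ, hab, hσ, ?_, hsum⟩
  have hστ : τ = σ := by
    rw [hx] at hcne
    simp only [Pi.add_apply, Finset.sum_add_distrib, Finset.sum_pi_single', Finset.mem_univ,
      if_true] at hcne
    omega
  rw [hστ] at hx
  simp only [hx, smul_add, ← Pi.single_smul, smul_eq_mul, mul_one]

end Switching

/-! ### Unfolding: from type D to type A. -/

/-- The bigraph with a given symmetric matrix; the diagonal entries are ignored. -/
def ofMatrix {V : Type*} [DecidableEq V] (A : Matrix V V ℤ) (hA : ∀ v w, A v w = A w v) :
    Bigraph V where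
  solid v w := if v = w then 0 else (-A v w).toNat
  dotted v w := if v = w then 0 else (A v w).toNat
  solid_symm v w := by rw [hA]; simp only [eq_comm]
  dotted_symm v w := by rw [hA]; simp only [eq_comm]
  solid_loopless v := by simp
  dotted_loopless v := by simp
  same_style v w := by split_ifs <;> omega

theorem toMatrix_ofMatrix {V : Type*} [DecidableEq V] {A : Matrix V V ℤ}
    (hA : ∀ v w, A v w = A w v) (h2 : ∀ v, A v v = 2) : (ofMatrix A hA).toMatrix = A := by
  ext v w
  simp only [toMatrix, ofMatrix, Matrix.of_apply]
  split_ifs with h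
  · rw [h, h2]
  · omega

theorem joins_of_eq {W P : Type*} [DecidableEq P] {s t : W → P} {w : W} {p q : P} {σ : ℤ}
    (hσ : σ = 1 ∨ σ = -1) (hne : s w ≠ t w)
    (h : (Pi.single (s w) 1 - Pi.single (t w) 1 : P → ℤ) =
      σ • (Pi.single q 1 - Pi.single p 1)) : Joins s t w p q σ := by
  have h1 := congrFun h (s w)
  have h2 := congrFun h (t w)
  simp only [Pi.sub_apply, Pi.smul_apply, Pi.single_apply, smul_eq_mul, if_neg hne,
    if_neg hne.symm] at h1 h2
  rcases hσ with rfl | rfl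
  · refine Or.inl ⟨rfl, ?_, ?_⟩
    · by_contra h3
      rw [if_neg h3] at h2
      split_ifs at h2 <;> omega
    · by_contra h3
      rw [if_neg h3] at h1
      split_ifs at h1 <;> omega
  · refine Or.inr ⟨rfl, ?_, ?_⟩
    · by_contra h3
      rw [if_neg h3] at h1
      split_ifs at h1 <;> omega
    · by_contra h3
      rw [if_neg h3] at h2
      split_ifs at h2 <;> omega

section Unfolding

variable {V P : Type*} [DecidableEq V] [DecidableEq P]

/-- The vectors obtained from `ρ` by replacing `ρ c = σ (e_a + e_b)` by two edges that join `a`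
and `b` to two new leaves. -/
def unfolding (ρ : V → P → ℤ) (c : V) (a b : P) (σ : ℤ) : Option V → P ⊕ Bool → ℤ
  | none => σ • (Pi.single (Sum.inl b) 1 - Pi.single (Sum.inr true) 1)
  | some v => if v = c then σ • (Pi.single (Sum.inl a) 1 - Pi.single (Sum.inr false) 1)
      else Sum.elim (ρ v) 0

theorem unfolding_some_of_ne {ρ : V → P → ℤ} {c : V} {a b : P} {σ : ℤ} {v : V} (hv : v ≠ c) :
    unfolding ρ c a b σ (some v) = Sum.elim (ρ v) 0 := by
  simp [unfolding, hv]

theorem unfolding_some_self {ρ : V → P → ℤ} {c : V} {a b : P} {σ : ℤ} :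
    unfolding ρ c a b σ (some c) =
      σ • (Pi.single (Sum.inl a) 1 - Pi.single (Sum.inr false) 1) := by
  simp [unfolding]

theorem unfolding_dotProduct_self [Fintype P] {G : Bigraph V} {ρ : V → P → ℤ}
    (hρ : G.IsRealizedBy ρ (evenSumLattice P)) {c : V} {a b : P} {σ : ℤ} (hσ : σ * σ = 1)
    (w : Option V) : unfolding ρ c a b σ w ⬝ᵥ unfolding ρ c a b σ w = 2 := by
  have hleaf : ∀ i : P ⊕ Bool, ∀ j, i ≠ j →
      (σ • (Pi.single i 1 - Pi.single j 1) : P ⊕ Bool → ℤ) ⬝ᵥ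
        (σ • (Pi.single i 1 - Pi.single j 1)) = 2 := by
    intro i j hij
    rw [smul_dotProduct, dotProduct_smul, sub_dotProduct, single_one_dotProduct,
      single_one_dotProduct]
    simp only [Pi.sub_apply, Pi.single_eq_same, Pi.single_eq_of_ne hij,
      Pi.single_eq_of_ne hij.symm, smul_eq_mul]
    linear_combination 2 * hσ
  cases w with
  | none => exact hleaf _ _ (by simp)
  | some v =>
    by_cases hv : v = c
    · rw [hv, unfolding_some_self]
      exact hleaf _ _ (by simp)
    · rw [unfolding_some_of_ne hv, dotProduct, Fintype.sum_sum_type]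
      simp only [Sum.elim_inl, Sum.elim_inr, Pi.zero_apply, mul_zero, Finset.sum_const_zero,
        add_zero]
      exact (hρ.gram v v).symm.trans (G.toMatrix_self v)

/-- Write e_i - e_a in terms of `ρ`. Since `ρ c` alone has nonzero coordinate sum 2σ, its
coefficient is zero, so the same combination exists among the unfolded vectors. The two new edges
then reach the two new points. -/
theorem span_unfolding [Fintype V] [Fintype P] {G : Bigraph V} {ρ : V → P → ℤ}
    (hρ : G.IsRealizedBy ρ (evenSumLattice P)) {c : V} {a b : P} {σ : ℤ} (hσ : σ * σ = 1)
    (hc : ρ c = σ • (Pi.single a 1 + Pi.single b 1)) (h0 : ∀ v, v ≠ c → ∑ i, ρ v i = 0) :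
    Submodule.span ℤ (Set.range (unfolding ρ c a b σ)) = sumZeroLattice (P ⊕ Bool) := by
  refine le_antisymm ?_ ?_
  · rw [Submodule.span_le]
    rintro _ ⟨w, rfl⟩
    cases w with
    | none => exact Submodule.smul_mem _ _ (single_sub_single_mem_sumZeroLattice _ _)
    | some v =>
      by_cases hv : v = c
      · rw [hv, unfolding_some_self]
        exact Submodule.smul_mem _ _ (single_sub_single_mem_sumZeroLattice _ _)
      · rw [unfolding_some_of_ne hv, SetLike.mem_coe, mem_sumZeroLattice, Fintype.sum_sum_type]
        simpa using h0 v hv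
  · set S := Submodule.span ℤ (Set.range (unfolding ρ c a b σ))
    have hmem : ∀ w, unfolding ρ c a b σ w ∈ S := fun w => Submodule.subset_span ⟨w, rfl⟩
    have hinl : ∀ i, (Pi.single (Sum.inl i) 1 - Pi.single (Sum.inl a) 1 : P ⊕ Bool → ℤ) ∈ S := by
      intro i
      have hi : (Pi.single i 1 - Pi.single a 1 : P → ℤ) ∈ evenSumLattice P := by
        simp [mem_evenSumLattice]
      rw [← hρ.span, Submodule.mem_span_range_iff_exists_fun] at hi
      obtain ⟨x, hx⟩ := hi
      have hxc : x c = 0 := by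
        have h1 : ∑ k, (∑ v, x v • ρ v) k = 0 := by
          rw [hx]
          simp
        simp only [Finset.sum_apply, Pi.smul_apply, smul_eq_mul] at h1
        rw [Finset.sum_comm] at h1
        simp only [← Finset.mul_sum] at h1
        rw [Finset.sum_eq_single c (fun v _ hv => by rw [h0 v hv, mul_zero])
          (fun h => absurd (Finset.mem_univ _) h), hc] at h1
        simp only [Pi.smul_apply, Pi.add_apply, smul_eq_mul, ← Finset.mul_sum,
          Finset.sum_add_distrib, Finset.sum_pi_single', Finset.mem_univ, if_true] at h1
        have h2 : 2 * x c = 0 := by linear_combination σ * h1 - 2 * x c * hσ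
        omega
      have hsum : (Pi.single (Sum.inl i) 1 - Pi.single (Sum.inl a) 1 : P ⊕ Bool → ℤ) =
          ∑ v, x v • unfolding ρ c a b σ (some v) := by
        have h1 : ∀ v, x v • unfolding ρ c a b σ (some v) = x v • Sum.elim (ρ v) 0 := by
          intro v
          by_cases hv : v = c
          · rw [hv, hxc, zero_smul, zero_smul]
          · rw [unfolding_some_of_ne hv]
        rw [Finset.sum_congr rfl fun v _ => h1 v]
        ext k
        rw [Finset.sum_apply]
        rcases k with k | k
        · have := congrFun hx k
          simp only [Finset.sum_apply, Pi.smul_apply, Pi.sub_apply, Pi.single_apply] at this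
          simp only [Pi.sub_apply, Pi.single_apply, Sum.inl.injEq, Pi.smul_apply, Sum.elim_inl, this]
        · simp
      rw [hsum]
      exact Submodule.sum_mem _ fun v _ => Submodule.smul_mem _ _ (hmem _)
    refine sumZeroLattice_le (Sum.inl a) fun i => ?_
    rcases i with i | (_ | _)
    · exact hinl i
    · have h1 := S.smul_mem (-σ) (hmem (some c))
      rw [unfolding_some_self, smul_smul, neg_mul, hσ] at h1
      simpa using h1
    · have h1 := S.add_mem (S.smul_mem (-σ) (hmem none)) (hinl b)
      rw [unfolding, smul_smul, neg_mul, hσ] at h1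
      simpa using h1

end Unfolding

/-- The vertices after the identification of `none` and `some c` correspond to the original ones. -/
def idVertexEquiv {V : Type*} [DecidableEq V] (c : V) :
    V ≃ IdVertex (none : Option V) (some c) where
  toFun v := if h : v = c then none else some ⟨some v, by simp, by simpa using h⟩
  invFun
    | none => c
    | some ⟨some v, _⟩ => v
    | some ⟨none, h⟩ => absurd rfl h.1
  left_inv v := by
    by_cases h : v = c
    · simp [h]
    · simp [h]
  right_inv
    | none => by simp
    | some ⟨some v, h⟩ => by
      have hv : v ≠ c := fun hv => h.2 (congrArg some hv)
      simp [hv]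
    | some ⟨none, h⟩ => absurd rfl h.1

theorem exists_isomorphic_identify {V : Type u} [Fintype V] [DecidableEq V] {n : ℕ} (hn : 3 ≤ n)
    {G : Bigraph V} (hV : Fintype.card V = n) (hG : G.HasDynkinType (CartanMatrix.D n)) :
    ∃ (W : Type u) (_ : Fintype W) (_ : DecidableEq W) (J : Bigraph W),
      J.HasDynkinType (CartanMatrix.A (n + 1)) ∧
      ∃ (x y : W), ¬ J.IsSeparating x ∧ ¬ J.IsSeparating y ∧
        ∃ hd : 2 ≤ J.graph.dist x y,
          (∃ p : J.graph.Walk x y, J.IsShortestPath p ∧ Odd (J.numDotted p)) ∧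
          G.Isomorphic (J.identify x y (J.not_adj_of_two_le_dist hd)) := by
  obtain ⟨r, hr⟩ := hG.exists_isRealizedBy_evenSumLattice hn
  obtain ⟨ρ, hρ, c, a, b, σ, hab, hσ, hc, h0⟩ :=
    hr.exists_switching (by simp [hV]) (by rw [Fintype.card_fin]; omega)
  have hσσ : σ * σ = 1 := by rcases hσ with rfl | rfl <;> norm_num
  set R := unfolding ρ c a b σ
  have hA : ∀ v w, (Matrix.of fun v w => R v ⬝ᵥ R w) v w =
      (Matrix.of fun v w => R v ⬝ᵥ R w) w v := fun v w => dotProduct_comm (R v) (R w)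
  set J : Bigraph (Option V) := ofMatrix (Matrix.of fun v w => R v ⬝ᵥ R w) hA with hJdef
  have hJ : J.IsRealizedBy R (sumZeroLattice (Fin n ⊕ Bool)) := by
    refine ⟨fun v w => ?_, span_unfolding hρ hσσ hc h0⟩
    rw [hJdef, toMatrix_ofMatrix hA fun v => unfolding_dotProduct_self hρ hσσ v]
    rfl
  have hW : Fintype.card (Option V) = n + 1 := by simp [hV]
  have hP : Fintype.card (Fin n ⊕ Bool) = n + 1 + 1 := by simp
  obtain ⟨s, t, hst, hT⟩ := hJ.exists_isTreeLineGraph (by rw [hP, hW])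
  have hRnone : R none = σ • (Pi.single (Sum.inl b) 1 - Pi.single (Sum.inr true) 1) := rfl
  have hRc : R (some c) = σ • (Pi.single (Sum.inl a) 1 - Pi.single (Sum.inr false) 1) :=
    unfolding_some_self
  have hRv : ∀ v, v ≠ c → R (some v) = Sum.elim (ρ v) 0 := fun v hv => unfolding_some_of_ne hv
  have hjx : Joins s t none (Sum.inr true) (Sum.inl b) σ :=
    joins_of_eq hσ (hT.ne _) ((hst none).symm.trans hRnone)
  have hjy : Joins s t (some c) (Sum.inr false) (Sum.inl a) σ :=
    joins_of_eq hσ (hT.ne _) ((hst (some c)).symm.trans hRc)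
  have hend : ∀ w i, R w i = 0 → ¬ IsEnd s t w i := by
    intro w i hi hw
    rw [hst, Pi.sub_apply] at hi
    have hne := hT.ne w
    rcases hw with rfl | rfl
    · simp [hne] at hi
    · simp [hne.symm] at hi
  have hleafx : ∀ w, w ≠ none → ¬ IsEnd s t w (Sum.inr true) := by
    rintro (_ | v) hw
    · exact absurd rfl hw
    · refine hend _ _ ?_
      by_cases hv : v = c
      · rw [hv, hRc]
        simp
      · rw [hRv v hv]
        rfl
  have hleafy : ∀ w, w ≠ some c → ¬ IsEnd s t w (Sum.inr false) := by
    rintro (_ | v) hw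
    · refine hend _ _ ?_
      rw [hRnone]
      simp
    · refine hend _ _ ?_
      rw [hRv v fun hv => hw (congrArg some hv)]
      rfl
  have hne : (none : Option V) ≠ some c := by simp
  -- The two new edges have different leaves, and their other ends `b` and `a` are distinct.
  have hnadj : ¬ J.graph.Adj none (some c) := by
    rw [hT.adj_iff]
    rintro ⟨-, i, hi, hi'⟩
    rw [hjx.isEnd_iff] at hi
    rw [hjy.isEnd_iff] at hi'
    rcases hi with rfl | rfl <;> simp [hab.symm] at hi'
  have hd : 2 ≤ J.graph.dist none (some c) :=
    hT.connected.one_lt_dist_of_ne_of_not_adj hne hnadj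
  obtain ⟨p, hp, -⟩ := hT.existsUnique_isShortestPath none (some c)
  refine ⟨Option V, inferInstance, inferInstance, J, hJ.hasDynkinType_A hW hP, none, some c,
    hT.not_isSeparating hjx.left hleafx, hT.not_isSeparating hjy.left hleafy, hd,
    ⟨p, hp, (hT.odd_numDotted_iff hne hp hjx hleafx hjy hleafy).mpr rfl⟩, ?_⟩
  -- `κ` records the two leaf coordinates of the refolded vectors. It is nonzero only at `c`, so it
  -- does not affect inner products of distinct vertices.
  obtain ⟨κ, hκ, hfib⟩ : ∃ κ : V → Bool → ℤ, (∀ v, v ≠ c → κ v = 0) ∧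
      ∀ v, fiberSum none (some c) R (idVertexEquiv c v) = Sum.elim (ρ v) (κ v) := by
    refine ⟨fun v => if v = c then fun _ => -σ else 0, fun v hv => if_neg hv, fun v => ?_⟩
    by_cases hv : v = c
    · subst hv
      have : idVertexEquiv v v = none := by simp [idVertexEquiv]
      rw [this, fiberSum_none hne, hRnone, hRc, hc]
      ext (k | (_ | _))
      · simp [Pi.single_apply]
        ring
      · simp
      · simp
    · have : idVertexEquiv c v = some ⟨some v, by simp, by simpa using hv⟩ := by
        simp [idVertexEquiv, hv]
      rw [this, fiberSum_some, hRv v hv]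
      simp only [hv, if_false]
  refine isomorphic_of_toMatrix_eq (idVertexEquiv c) fun v w hvw => ?_
  rw [hJ.toMatrix_identify _ _ _ ((idVertexEquiv c).injective.ne hvw), hfib, hfib, hρ.gram]
  simp only [dotProduct, Fintype.sum_sum_type, Sum.elim_inl, Sum.elim_inr]
  rw [left_eq_add]
  refine Finset.sum_eq_zero fun k _ => ?_
  by_cases hv : v = c
  · rw [hκ w fun hw => hvw (hv.trans hw.symm), Pi.zero_apply, mul_zero]
  · rw [hκ v hv, Pi.zero_apply, zero_mul]

end Bigraph

/-- The first part says that the shortest path mentioned in the second part is unique. -/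
theorem mainTheorem3 (n : ℕ) (hn : 4 ≤ n) :
    (∀ (W : Type u) [Fintype W] [DecidableEq W] (J : Bigraph W),
      J.HasDynkinType (CartanMatrix.A (n + 1)) →
        ∀ x y : W, ∃! p : J.graph.Walk x y, J.IsShortestPath p) ∧
    (∀ (V : Type u) [Fintype V] [DecidableEq V] (G : Bigraph V), Fintype.card V = n →
      (G.HasDynkinType (CartanMatrix.D n) ↔
        ∃ (W : Type u) (_ : Fintype W) (_ : DecidableEq W) (J : Bigraph W),
          J.HasDynkinType (CartanMatrix.A (n + 1)) ∧
          ∃ (x y : W), ¬ J.IsSeparating x ∧ ¬ J.IsSeparating y ∧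
            ∃ hd : 2 ≤ J.graph.dist x y,
              (∃ p : J.graph.Walk x y, J.IsShortestPath p ∧ Odd (J.numDotted p)) ∧
              G.Isomorphic (J.identify x y (J.not_adj_of_two_le_dist hd)))) := by
  refine ⟨fun W _ _ J hJ x y => ?_, fun V _ _ G hV => ⟨fun hG => ?_, ?_⟩⟩
  · obtain ⟨r, hr⟩ := hJ.exists_isRealizedBy_sumZeroLattice
    obtain ⟨s, t, -, hT⟩ := hr.exists_isTreeLineGraph (by simp [hJ.card_eq])
    exact hT.existsUnique_isShortestPath x y
  · exact Bigraph.exists_isomorphic_identify (by omega) hV hG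
  · rintro ⟨W, _, _, J, hJ, x, y, hx, hy, hd, ⟨p, hp, hodd⟩, hiso⟩
    exact Bigraph.hasDynkinType_D_of_isomorphic_identify (by omega) hV hJ hx hy hd hp hodd hiso
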